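/- Let $d\ge 1$ be an integer, $\tau>0$, $s\in\mathbb R$, $h\ge\tau$, and put $X=L^2([-\tau,0],\mathbb R^d)$, $X^+=L^2([0,h],\mathbb R^d)$, $H^{1,+}=H^1([0,h],\mathbb R^d)$ with $\|w\|_{H^{1,+}}^2=\|w\|_{X^+}^2+\|w'\|_{X^+}^2$. Let $C(t,\theta)\in\mathbb R^{d\times d}$ be a matrix-valued kernel. For $\phi\in X$ and $w\in X^+$ let $V(\phi,w)$ be the function on $[-\tau,h]$ equal to $\phi$ on $[-\tau,0]$ and to $w$ on $(0,h]$; for $v\in L^2([-\tau,h],\mathbb R^d)$ let $$(\mathcal F v)(t)=\int_{-\tau}^0 C(s+t,\theta)\,v(t+\theta)\,d\theta,\qquad t\in[0,h].$$ Assume: (H1) $C\in L^\infty([s,s+h]\times[-\tau,0],\mathbb R^{d\times d})$; (H2) $w\mapsto \mathcal F V(0,w)$ maps $X^+$ into $H^{1,+}$ and is bounded from $X^+$ to $H^{1,+}$; (H3) $\phi\mapsto \mathcal F V(\phi,0)$ maps $X$ into $H^{1,+}$ and is bounded from $X$ to $H^{1,+}$. For $N\ge1$ let $\mathcal L_N$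 be Lagrange interpolation at the zeros of the Legendre polynomial of degree $N$ on $[0,h]$, applied to elements of $H^{1,+}$ through their continuous representatives. Then: 1. For every $\phi\in X$ there is a unique $x\in L^2([s-\tau,s+h],\mathbb R^d)$ with $x(s+\theta)=\phi(\theta)$ for a.e. $\theta\in[-\tau,0]$ and $x(t)=\int_{-\tau}^0C(t,\theta)x(t+\theta)\,d\theta$ for a.e. $t\in(s,s+h)$, and $(T\phi)(\theta)=x(s+h+\theta)$, $\theta\in[-\tau,0]$, defines a bounded linear operator $T\colon X\to X$ (the evolution operator $T(s+h,s)$). 2. There is $N_0$ such that for all $N\ge N_0$ and all $\phi\in X$ the equation $w=\mathcal L_N\mathcal F V(\phi,w)$ has a unique solution $w^*_N\in X^+$, and $(T_N\phi)(\theta)=V(\phi,w^*_N)(h+\theta)$, $\theta\in[-\tau,0]$, defines a bounded linear operator $T_N\colon X\to X$. 3. $\|T_N-T\|_{X\leftarrow X}\to0$ as $N\to\infty$. -/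

import Mathlib

open MeasureTheory Set Filter Topology
open scoped ENNReal ContDiff

noncomputable section

namespace RenewalEq

/-- `ℝ^d` with the Euclidean norm. -/
abbrev Vec (d : ℕ) : Type := EuclideanSpace ℝ (Fin d)

/-- `L²([a,b], ℝ^d)`. -/
abbrev L2 (d : ℕ) (a b : ℝ) : Type := Lp (Vec d) 2 (volume.restrict (Icc a b))

/-- `g` is the weak derivative of `f` on `(a,b)`: both are in `L²`, and
`∫ η' f = - ∫ η g` for every test function `η ∈ C_c^∞((a,b))`. -/
def IsWeakDeriv {d : ℕ} {a b : ℝ} (f g : L2 d a b) : Prop :=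
  ∀ η : ℝ → ℝ, ContDiff ℝ ∞ η → HasCompactSupport η → tsupport η ⊆ Ioo a b →
    ∫ t in Icc a b, deriv η t • f t = - ∫ t in Icc a b, η t • g t

lemma integrable_smul_L2 {d : ℕ} {a b : ℝ} (f : L2 d a b) {η : ℝ → ℝ}
    (hη : Continuous η) (hc : HasCompactSupport η) :
    Integrable (fun t => η t • f t) (volume.restrict (Icc a b)) := by
  obtain ⟨C, hC⟩ := hc.exists_bound_of_continuous hη
  exact ((Lp.memLp f).integrable (by norm_num)).bdd_smul C
    hη.aestronglyMeasurable (Eventually.of_forall hC)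

/-- The Sobolev space `H¹([a,b], ℝ^d)`, realised as the space of pairs `(f, f')` with `f ∈ L²` and
`f' ∈ L²` the weak derivative of `f`. The norm is the one inherited from the Hilbert product
`L² × L²`, that is `‖f‖²_{H¹} = ‖f‖²_{L²} + ‖f'‖²_{L²}`. -/
def H1 (d : ℕ) (a b : ℝ) : Submodule ℝ (WithLp 2 (L2 d a b × L2 d a b)) where
  carrier := {p | IsWeakDeriv p.fst p.snd}
  zero_mem' := by
    intro η _ _ _
    have h0 := Lp.coeFn_zero (Vec d) 2 (volume.restrict (Icc a b))
    have h1 : ∀ ζ : ℝ → ℝ, ∫ t in Icc a b, ζ t • (0 : L2 d a b) t = 0 := by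
      intro ζ
      refine integral_eq_zero_of_ae ?_
      filter_upwards [h0] with t ht
      rw [ht]; simp
    change ∫ t in Icc a b, deriv η t • (0 : L2 d a b) t
      = - ∫ t in Icc a b, η t • (0 : L2 d a b) t
    rw [h1, h1, neg_zero]
  add_mem' := by
    intro p q hp hq η h1 h2 h3
    have key : ∀ (f g : L2 d a b) (ζ : ℝ → ℝ), Continuous ζ → HasCompactSupport ζ →
        ∫ t in Icc a b, ζ t • (f + g : L2 d a b) t
          = (∫ t in Icc a b, ζ t • f t) + ∫ t in Icc a b, ζ t • g t := by
      intro f g ζ hζ hζc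
      rw [← integral_add (integrable_smul_L2 f hζ hζc) (integrable_smul_L2 g hζ hζc)]
      refine integral_congr_ae ?_
      filter_upwards [Lp.coeFn_add f g] with t ht
      rw [ht, Pi.add_apply, smul_add]
    change ∫ t in Icc a b, deriv η t • (p.fst + q.fst : L2 d a b) t
      = - ∫ t in Icc a b, η t • (p.snd + q.snd : L2 d a b) t
    rw [key _ _ _ (h1.continuous_deriv (by simp)) h2.deriv, key _ _ _ h1.continuous h2,
      hp η h1 h2 h3, hq η h1 h2 h3, neg_add]
  smul_mem' := by
    intro c p hp η h1 h2 h3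
    have key : ∀ (f : L2 d a b) (ζ : ℝ → ℝ),
        ∫ t in Icc a b, ζ t • (c • f : L2 d a b) t = c • ∫ t in Icc a b, ζ t • f t := by
      intro f ζ
      rw [← integral_smul]
      refine integral_congr_ae ?_
      filter_upwards [Lp.coeFn_smul c f] with t ht
      rw [ht, Pi.smul_apply, smul_comm]
    change ∫ t in Icc a b, deriv η t • (c • p.fst : L2 d a b) t
      = - ∫ t in Icc a b, η t • (c • p.snd : L2 d a b) t
    rw [key, key, hp η h1 h2 h3, smul_neg]

/-- The element of `L²` underlying an element of `H¹`. -/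
def H1.toL2 {d : ℕ} {a b : ℝ} (u : H1 d a b) : L2 d a b := u.1.fst

/-- `x ∈ L²([s-τ,s+h], ℝ^d)` solves the initial value problem
`x(t) = ∫_{-τ}^0 C(t,θ) x(t+θ) dθ` for (almost every) `t ∈ (s,s+h)`, `x_s = φ`. -/
def IsSolution {d : ℕ} (τ s h : ℝ) (C : ℝ → ℝ → Matrix (Fin d) (Fin d) ℝ)
    (φ : L2 d (-τ) 0) (x : L2 d (s - τ) (s + h)) : Prop :=
  (∀ᵐ θ ∂volume.restrict (Icc (-τ) 0), x (s + θ) = φ θ) ∧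
  ∀ᵐ t ∂volume.restrict (Ioc s (s + h)),
    x t = ∫ θ in Icc (-τ) 0, (C t θ).toEuclideanLin (x (t + θ))

/-- `T` is the evolution operator `T(s+h,s)`: `T φ = x_{s+h}` for the solution `x` of the initial
value problem at time `s` with datum `φ`. -/
def IsEvolutionOperator {d : ℕ} (τ s h : ℝ) (C : ℝ → ℝ → Matrix (Fin d) (Fin d) ℝ)
    (T : L2 d (-τ) 0 →L[ℝ] L2 d (-τ) 0) : Prop :=
  ∀ (φ : L2 d (-τ) 0) (x : L2 d (s - τ) (s + h)), IsSolution τ s h C φ x →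
    T φ =ᵐ[volume.restrict (Icc (-τ) 0)] fun θ => x (s + h + θ)

/-- `V(φ,w)`, equal to `w` on `(0,h]` and to `φ` on `[-τ,0]`. -/
def V {d : ℕ} (φ w : ℝ → Vec d) (t : ℝ) : Vec d := if 0 < t then w t else φ t

/-- `(𝓕 v)(t) = ∫_{-τ}^0 C(s+t,θ) v(t+θ) dθ`; for `t ∈ [0,h]` it involves only the values of `v` on
`[-τ,h]`. -/
def opF {d : ℕ} (τ s : ℝ) (C : ℝ → ℝ → Matrix (Fin d) (Fin d) ℝ) (v : ℝ → Vec d) (t : ℝ) : Vec d :=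
  ∫ θ in Icc (-τ) 0, (C (s + t) θ).toEuclideanLin (v (t + θ))

/-- `C ∈ L^∞([s,s+h] × [-τ,0], ℝ^{d×d})`, stated entrywise. -/
def HypC {d : ℕ} (τ s h : ℝ) (C : ℝ → ℝ → Matrix (Fin d) (Fin d) ℝ) : Prop :=
  ∀ i j, MemLp (fun p : ℝ × ℝ => C p.1 p.2 i j) ∞
    (volume.restrict (Icc s (s + h) ×ˢ Icc (-τ) 0))

/-- `𝓕 V⁺`, with `V⁺ w = V(0,w)`, is a bounded operator from `L²([0,h])` to `H¹([0,h])`. -/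
def HypPlus {d : ℕ} (τ s h : ℝ) (C : ℝ → ℝ → Matrix (Fin d) (Fin d) ℝ) : Prop :=
  ∃ A : L2 d 0 h →L[ℝ] H1 d 0 h, ∀ w : L2 d 0 h,
    H1.toL2 (A w) =ᵐ[volume.restrict (Icc 0 h)] opF τ s C (V 0 w)

/-- `𝓕 V⁻`, with `V⁻ φ = V(φ,0)`, is a bounded operator from `L²([-τ,0])` to `H¹([0,h])`. -/
def HypMinus {d : ℕ} (τ s h : ℝ) (C : ℝ → ℝ → Matrix (Fin d) (Fin d) ℝ) : Prop :=
  ∃ A : L2 d (-τ) 0 →L[ℝ] H1 d 0 h, ∀ φ : L2 d (-τ) 0,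
    H1.toL2 (A φ) =ᵐ[volume.restrict (Icc 0 h)] opF τ s C (V φ 0)

/-- The Legendre polynomial of degree `N` on `[0,h]`. -/
def legendre (h : ℝ) (N : ℕ) : Polynomial ℝ :=
  ((Polynomial.shiftedLegendre N).map (Int.castRingHom ℝ)).comp
    (Polynomial.C h⁻¹ * Polynomial.X)

/-- The collocation nodes: the zeros of the Legendre polynomial of degree `N` on `[0,h]`. -/
def nodes (h : ℝ) (N : ℕ) : Finset ℝ := (legendre h N).roots.toFinset

/-- `𝓛_N u = ∑_i ℓ_i u(θ_i)`, the Lagrange interpolant of `u` at the nodes `θ_i`. -/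
def lagrangeInterp {d : ℕ} (h : ℝ) (N : ℕ) (u : ℝ → Vec d) (t : ℝ) : Vec d :=
  ∑ θ ∈ nodes h N, (Lagrange.basis (nodes h N) id θ).eval t • u θ

/-- `w ∈ L²([0,h])` solves `w = 𝓛_N 𝓕 V(φ,w)`. As usual for elements of `H¹`, point values of
`𝓕 V(φ,w)` are those of its continuous representative `u` on `[0,h]`. -/
def IsCollocationSolution {d : ℕ} (τ s h : ℝ) (C : ℝ → ℝ → Matrix (Fin d) (Fin d) ℝ) (N : ℕ)
    (φ : L2 d (-τ) 0) (w : L2 d 0 h) : Prop :=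
  ∃ u : ℝ → Vec d, ContinuousOn u (Icc 0 h) ∧
    u =ᵐ[volume.restrict (Icc 0 h)] opF τ s C (V φ w) ∧
    w =ᵐ[volume.restrict (Icc 0 h)] lagrangeInterp h N u

/-- `T_N φ = V(φ, w*_N)_h`, where `w*_N` solves `w = 𝓛_N 𝓕 V(φ,w)`. -/
def IsCollocationOperator {d : ℕ} (τ s h : ℝ) (C : ℝ → ℝ → Matrix (Fin d) (Fin d) ℝ) (N : ℕ)
    (T : L2 d (-τ) 0 →L[ℝ] L2 d (-τ) 0) : Prop :=
  ∀ (φ : L2 d (-τ) 0) (w : L2 d 0 h), IsCollocationSolution τ s h C N φ w →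
    T φ =ᵐ[volume.restrict (Icc (-τ) 0)] fun θ => V φ w (h + θ)

end RenewalEq

end

/-!
The map `(φ,w) ↦ 𝓕 V(φ,w)` is a bounded operator `A` into `H¹`, so with `J : H¹ → L²` the embedding,
the exact equation is `w = J A(φ,w)` and the collocation equation is `w = 𝓛_N A(φ,w)`. As
`𝓕 V(0,w)(t)` only depends on `w` up to time `t`, the operator `J A(0,·)` is of Volterra type, and
`1 - J A(0,·)` is invertible. It remains to see that `𝓛_N → J` in the operator norm of `H¹ → L²`,
since inversion is continuous at invertible operators. On the one hand `‖𝓛_N u‖₂ ≤ √h ‖u‖_∞`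
(Erdős–Turán), because Gauss quadrature is exact in degree `< 2N` and has positive weights; as `𝓛_N`
reproduces polynomials of degree `< N`, the interpolation error is at most `2 √h` times the distance
from `u` to those polynomials. On the other hand functions of the unit ball of `H¹` are uniformly
`1/2`-Hölder, so that distance is bounded uniformly by means of Bernstein polynomials.
-/

namespace RenewalEq

section OrthogonalPolynomials

open Polynomial

/-- `p` is orthogonal, in `L²(μ)`, to every polynomial of smaller degree. -/
def IsOrthogonalPolynomial (μ : Measure ℝ) (p : ℝ[X]) : Prop :=
  ∀ q : ℝ[X], q.degree < p.degree → ∫ x, (p * q).eval x ∂μ = 0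

lemma IsOrthogonalPolynomial.of_C_mul {μ : Measure ℝ} {c : ℝ} {p : ℝ[X]} (hc : c ≠ 0)
    (horth : IsOrthogonalPolynomial μ (C c * p)) : IsOrthogonalPolynomial μ p := by
  intro q hq
  have hint := horth q (by rwa [degree_C_mul hc])
  simp only [mul_assoc, eval_mul (p := C _), eval_C, integral_const_mul] at hint
  exact (mul_eq_zero.1 hint).resolve_left hc

variable {a b : ℝ} {p q : ℝ[X]}

lemma integrableOn_eval_Icc (p : ℝ[X]) (a b : ℝ) : IntegrableOn (fun x ↦ p.eval x) (Icc a b) :=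
  p.continuous.integrableOn_Icc

lemma integral_eval_pos_of_nonneg_on_Ioo (hab : a < b) (hp : p ≠ 0)
    (hnonneg : ∀ x ∈ Ioo a b, 0 ≤ p.eval x) : 0 < ∫ x in Icc a b, p.eval x := by
  obtain ⟨x, hx, hpx⟩ : ∃ x ∈ Ioo a b, p.eval x ≠ 0 := by
    by_contra! hzero
    exact hp (p.eq_zero_of_infinite_isRoot ((Ioo_infinite hab).mono hzero))
  rw [integral_Icc_eq_integral_Ioo, setIntegral_pos_iff_support_of_nonneg_ae
    ((ae_restrict_iff' measurableSet_Ioo).2 (Eventually.of_forall hnonneg))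
    ((integrableOn_eval_Icc p a b).mono_set Ioo_subset_Icc_self)]
  have hopen : IsOpen (Function.support (fun x ↦ p.eval x) ∩ Ioo a b) :=
    (isOpen_ne_fun p.continuous continuous_const).inter isOpen_Ioo
  exact hopen.measure_pos volume ⟨x, hpx, hx⟩

/-- Otherwise `∫ p (p / q) = ∫ q (p / q)²` would be positive. -/
lemma IsOrthogonalPolynomial.exists_eval_neg_of_dvd (hab : a < b) (hp : p ≠ 0)
    (horth : IsOrthogonalPolynomial (volume.restrict (Icc a b)) p) (hqp : q ∣ p)
    (hq : 0 < q.degree) : ∃ x ∈ Ioo a b, q.eval x < 0 := by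
  by_contra! hnonneg
  obtain ⟨r, rfl⟩ := hqp
  obtain ⟨hq0, hr0⟩ := mul_ne_zero_iff.1 hp
  have hlt : r.degree < (q * r).degree := by
    rw [degree_mul, degree_eq_natDegree hr0, degree_eq_natDegree hq0] at *
    norm_cast at *
    omega
  refine (integral_eval_pos_of_nonneg_on_Ioo hab (mul_ne_zero hp hr0) fun x hx ↦ ?_).ne'
    (horth r hlt)
  rw [mul_assoc, eval_mul, eval_mul]
  exact mul_nonneg (hnonneg x hx) (mul_self_nonneg _)

lemma IsOrthogonalPolynomial.mem_Ioo_of_isRoot (hab : a < b) (hp : p ≠ 0)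
    (horth : IsOrthogonalPolynomial (volume.restrict (Icc a b)) p) {r : ℝ} (hr : p.IsRoot r) :
    r ∈ Ioo a b := by
  have hdvd : X - C r ∣ p := dvd_iff_isRoot.2 hr
  have hdeg : 0 < (X - C r).degree := by rw [degree_X_sub_C]; exact one_pos
  obtain ⟨x, hx, hxr⟩ := horth.exists_eval_neg_of_dvd hab hp hdvd hdeg
  obtain ⟨y, hy, hyr⟩ := horth.exists_eval_neg_of_dvd hab hp (neg_dvd.2 hdvd)
    (by rwa [degree_neg])
  simp only [eval_neg, eval_sub, eval_X, eval_C] at hxr hyr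
  exact ⟨by linarith [hy.1, hx.1], by linarith [hx.2, hy.2]⟩

lemma IsOrthogonalPolynomial.nodup_roots (hab : a < b) (hp : p ≠ 0)
    (horth : IsOrthogonalPolynomial (volume.restrict (Icc a b)) p) : p.roots.Nodup := by
  refine Multiset.nodup_iff_count_le_one.2 fun r ↦ ?_
  by_contra! hr
  have hdvd : (X - C r) ^ 2 ∣ p :=
    (le_rootMultiplicity_iff hp).1 (by rwa [count_roots] at hr)
  obtain ⟨x, -, hx⟩ := horth.exists_eval_neg_of_dvd hab hp hdvd (by simp)
  rw [eval_pow] at hx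
  exact (sq_nonneg _).not_gt hx

/-- The factor of `p` without real roots keeps its sign, so it is constant. -/
lemma IsOrthogonalPolynomial.splits (hab : a < b) (hp : p ≠ 0)
    (horth : IsOrthogonalPolynomial (volume.restrict (Icc a b)) p) : p.Splits := by
  obtain ⟨q, hqp, hcard, hroots⟩ := exists_prod_multiset_X_sub_C_mul p
  rw [splits_iff_card_roots, ← hcard, left_eq_add]
  by_contra hdeg
  have hdvd : q ∣ p := Dvd.intro_left _ hqp
  have hpos : 0 < q.degree := natDegree_pos_iff_degree_pos.1 (Nat.pos_of_ne_zero hdeg)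
  obtain ⟨x, -, hx⟩ := horth.exists_eval_neg_of_dvd hab hp hdvd hpos
  obtain ⟨y, -, hy⟩ := horth.exists_eval_neg_of_dvd hab hp (neg_dvd.2 hdvd) (by rwa [degree_neg])
  rw [eval_neg, neg_lt_zero] at hy
  obtain ⟨r, hr⟩ := mem_range_of_exists_le_of_exists_ge q.continuous ⟨x, hx.le⟩ ⟨y, hy.le⟩
  have hmem : r ∈ q.roots := (mem_roots (ne_zero_of_degree_gt hpos)).2 hr
  simp [hroots] at hmem

lemma IsOrthogonalPolynomial.eq_C_mul_nodal (hab : a < b) (hp : p ≠ 0)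
    (horth : IsOrthogonalPolynomial (volume.restrict (Icc a b)) p) :
    p = C p.leadingCoeff * Lagrange.nodal p.roots.toFinset id := by
  rw [Lagrange.nodal, Finset.prod, Multiset.toFinset_val, (horth.nodup_roots hab hp).dedup]
  exact (horth.splits hab hp).eq_prod_roots

lemma IsOrthogonalPolynomial.nodal (hab : a < b) (hp : p ≠ 0)
    (horth : IsOrthogonalPolynomial (volume.restrict (Icc a b)) p) :
    IsOrthogonalPolynomial (volume.restrict (Icc a b)) (Lagrange.nodal p.roots.toFinset id) :=
  .of_C_mul (leadingCoeff_ne_zero.2 hp) (horth.eq_C_mul_nodal hab hp ▸ horth)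

end OrthogonalPolynomials

section Legendre

open Polynomial

lemma integral_mul_iterate_derivative {a b : ℝ} {n : ℕ} (p : ℝ[X]) {q : ℝ[X]}
    (ha : ∀ j < n, (derivative^[j] q).eval a = 0) (hb : ∀ j < n, (derivative^[j] q).eval b = 0) :
    ∫ x in a..b, (p * derivative^[n] q).eval x =
      (-1) ^ n * ∫ x in a..b, (derivative^[n] p * q).eval x := by
  induction n generalizing p with
  | zero => simp
  | succ n ih =>
    have hparts := intervalIntegral.integral_mul_deriv_eq_deriv_mul (a := a) (b := b)
      (fun x _ ↦ p.hasDerivAt x) (fun x _ ↦ (derivative^[n] q).hasDerivAt x)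
      ((derivative p).continuous.intervalIntegrable a b)
      ((derivative (derivative^[n] q)).continuous.intervalIntegrable a b)
    simp only [ha n n.lt_succ_self, hb n n.lt_succ_self, mul_zero, sub_zero, zero_sub, ← eval_mul,
      ← Function.iterate_succ_apply'] at hparts
    rw [hparts, ih _ (fun j hj ↦ ha j (hj.trans n.lt_succ_self))
      (fun j hj ↦ hb j (hj.trans n.lt_succ_self)), ← Function.iterate_succ_apply, pow_succ]
    ring

lemma eval_iterate_derivative_eq_zero_of_pow_dvd {p : ℝ[X]} {r : ℝ} {j n : ℕ} (hj : j < n)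
    (hdvd : (X - C r) ^ n ∣ p) : (derivative^[j] p).eval r = 0 :=
  dvd_iff_isRoot.1 <| (dvd_pow_self _ (Nat.sub_ne_zero_of_lt hj)).trans
    (pow_sub_dvd_iterate_derivative_of_pow_dvd j hdvd)

lemma isOrthogonalPolynomial_iterate_derivative {a b : ℝ} {n : ℕ} (hab : a ≤ b)
    {q : ℝ[X]} (ha : (X - C a) ^ n ∣ q) (hb : (X - C b) ^ n ∣ q)
    (hdeg : (derivative^[n] q).degree ≤ n) :
    IsOrthogonalPolynomial (volume.restrict (Icc a b)) (derivative^[n] q) := by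
  intro p hp
  rw [integral_Icc_eq_integral_Ioc, ← intervalIntegral.integral_of_le hab, mul_comm,
    integral_mul_iterate_derivative p
      (fun j hj ↦ eval_iterate_derivative_eq_zero_of_pow_dvd hj ha)
      (fun j hj ↦ eval_iterate_derivative_eq_zero_of_pow_dvd hj hb),
    iterate_derivative_eq_zero_of_degree_lt (hp.trans_le hdeg)]
  simp

lemma degree_comp_C_mul_X {c : ℝ} (hc : c ≠ 0) (p : ℝ[X]) :
    (p.comp (C c * X)).degree = p.degree := by
  rw [degree_comp (by rw [degree_C_mul_X hc]; exact one_pos), degree_C_mul_X hc, mul_one]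

lemma IsOrthogonalPolynomial.comp_C_inv_mul_X {h : ℝ} (hh : 0 < h) {p : ℝ[X]}
    (horth : IsOrthogonalPolynomial (volume.restrict (Icc 0 1)) p) :
    IsOrthogonalPolynomial (volume.restrict (Icc 0 h)) (p.comp (C h⁻¹ * X)) := by
  intro q hq
  have hint := horth (q.comp (C h * X)) (by
    rwa [degree_comp_C_mul_X hh.ne', ← degree_comp_C_mul_X (inv_ne_zero hh.ne') p])
  rw [integral_Icc_eq_integral_Ioc, ← intervalIntegral.integral_of_le zero_le_one] at hint
  rw [integral_Icc_eq_integral_Ioc, ← intervalIntegral.integral_of_le hh.le]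
  have hscale := intervalIntegral.integral_comp_div (a := 0) (b := h)
    (fun x ↦ (p * q.comp (C h * X)).eval x) hh.ne'
  rw [zero_div, div_self hh.ne', hint, smul_zero] at hscale
  refine Eq.trans (intervalIntegral.integral_congr fun x _ ↦ ?_) hscale
  simp [div_eq_inv_mul, hh.ne']

lemma isOrthogonalPolynomial_shiftedLegendre (N : ℕ) :
    IsOrthogonalPolynomial (volume.restrict (Icc 0 1))
      ((shiftedLegendre N).map (Int.castRingHom ℝ)) := by
  have hrodrigues : C (N.factorial : ℝ) * (shiftedLegendre N).map (Int.castRingHom ℝ) =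
      derivative^[N] (X ^ N * (1 - X) ^ N) := by
    have h := congrArg (Polynomial.map (Int.castRingHom ℝ)) (factorial_mul_shiftedLegendre_eq N)
    rw [← Polynomial.iterate_derivative_map] at h
    simpa using h
  have hfactorial : (N.factorial : ℝ) ≠ 0 := by positivity
  refine .of_C_mul hfactorial ?_
  have hdegree : (derivative^[N] (X ^ N * (1 - X) ^ N : ℝ[X])).degree ≤ N := by
    rw [← hrodrigues, degree_C_mul hfactorial]
    exact degree_map_le.trans (degree_shiftedLegendre N).le
  rw [hrodrigues]
  refine isOrthogonalPolynomial_iterate_derivative zero_le_one ?_ ?_ hdegree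
  · rw [C_0, sub_zero]
    exact dvd_mul_right _ _
  · rw [C_1, ← neg_sub 1 X]
    exact Dvd.dvd.mul_left (pow_dvd_pow_of_dvd (neg_dvd.2 dvd_rfl) N) _

variable {h : ℝ} (hh : 0 < h) (N : ℕ)
include hh

lemma isOrthogonalPolynomial_legendre :
    IsOrthogonalPolynomial (volume.restrict (Icc 0 h)) (legendre h N) :=
  (isOrthogonalPolynomial_shiftedLegendre N).comp_C_inv_mul_X hh

lemma degree_legendre : (legendre h N).degree = N := by
  rw [legendre, degree_comp_C_mul_X (inv_ne_zero hh.ne'),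
    degree_map_eq_of_injective (RingHom.injective_int _), degree_shiftedLegendre]

lemma legendre_ne_zero : legendre h N ≠ 0 :=
  ne_zero_of_degree_gt (n := ⊥) (by rw [degree_legendre hh]; exact WithBot.bot_lt_coe N)

lemma card_nodes : (nodes h N).card = N := by
  have horth := isOrthogonalPolynomial_legendre hh N
  have hne := legendre_ne_zero hh N
  rw [nodes, Multiset.toFinset_card_of_nodup (horth.nodup_roots hh hne),
    ← (horth.splits hh hne).natDegree_eq_card_roots,
    natDegree_eq_of_degree_eq_some (degree_legendre hh N)]

lemma nodes_subset_Icc : ↑(nodes h N) ⊆ Icc 0 h := fun _ hx ↦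
  Ioo_subset_Icc_self <| (isOrthogonalPolynomial_legendre hh N).mem_Ioo_of_isRoot hh
    (legendre_ne_zero hh N) (isRoot_of_mem_roots (Multiset.mem_toFinset.1 hx))

lemma isOrthogonalPolynomial_nodal_nodes :
    IsOrthogonalPolynomial (volume.restrict (Icc 0 h)) (Lagrange.nodal (nodes h N) id) :=
  (isOrthogonalPolynomial_legendre hh N).nodal hh (legendre_ne_zero hh N)

end Legendre

section GaussQuadrature

open Polynomial

variable {μ : Measure ℝ} {s : Finset ℝ}

lemma integral_eval_eq_sum_gaussQuadrature (hint : ∀ f : ℝ[X], Integrable (fun x ↦ f.eval x) μ)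
    (horth : IsOrthogonalPolynomial μ (Lagrange.nodal s id)) {f : ℝ[X]}
    (hf : f.degree < 2 * s.card) :
    ∫ x, f.eval x ∂μ = ∑ θ ∈ s, f.eval θ * ∫ x, (Lagrange.basis s id θ).eval x ∂μ := by
  have hmonic : (Lagrange.nodal s id : ℝ[X]).Monic := Lagrange.nodal_monic
  have hdecomp := modByMonic_add_div f (Lagrange.nodal s id)
  have hmod : f %ₘ Lagrange.nodal s id = Lagrange.interpolate s id fun θ ↦ f.eval θ := by
    refine Lagrange.eq_interpolate_of_eval_eq _ (injOn_id _) ?_ fun θ hθ ↦ ?_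
    · exact (degree_modByMonic_lt f hmonic).trans_eq Lagrange.degree_nodal
    · have hnode : (Lagrange.nodal s id).eval θ = 0 := Lagrange.eval_nodal_at_node (v := id) hθ
      conv_rhs => rw [← hdecomp]
      simp [hnode]
  have hdiv : (f /ₘ Lagrange.nodal s id).degree < (Lagrange.nodal s id : ℝ[X]).degree := by
    rw [Lagrange.degree_nodal]
    rcases lt_or_ge f.degree (Lagrange.nodal s id : ℝ[X]).degree with hlt | hge
    · rw [(divByMonic_eq_zero_iff hmonic).2 hlt]
      exact WithBot.bot_lt_coe _
    · rw [← degree_add_divByMonic hmonic hge, Lagrange.degree_nodal, two_mul] at hf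
      exact lt_of_add_lt_add_left hf
  calc ∫ x, f.eval x ∂μ
      = ∫ x, (f %ₘ Lagrange.nodal s id).eval x ∂μ
          + ∫ x, (Lagrange.nodal s id * (f /ₘ Lagrange.nodal s id)).eval x ∂μ := by
        rw [← integral_add (hint _) (hint _)]
        simp only [← eval_add, hdecomp]
    _ = ∑ θ ∈ s, f.eval θ * ∫ x, (Lagrange.basis s id θ).eval x ∂μ := by
        rw [horth _ hdiv, add_zero, hmod, Lagrange.interpolate_apply]
        simp only [eval_finsetSum, eval_mul, eval_C]
        rw [integral_finsetSum _ fun θ _ ↦ (hint _).const_mul _]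
        simp only [integral_const_mul]

lemma integral_eval_basis_mul_basis (hint : ∀ f : ℝ[X], Integrable (fun x ↦ f.eval x) μ)
    (horth : IsOrthogonalPolynomial μ (Lagrange.nodal s id)) {i j : ℝ} (hi : i ∈ s) (hj : j ∈ s) :
    ∫ x, (Lagrange.basis s id i * Lagrange.basis s id j).eval x ∂μ =
      if i = j then ∫ x, (Lagrange.basis s id i).eval x ∂μ else 0 := by
  have hdeg : (Lagrange.basis s id i * Lagrange.basis s id j).degree < 2 * s.card := by
    rw [degree_mul, Lagrange.degree_basis (injOn_id _) hi, Lagrange.degree_basis (injOn_id _) hj]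
    have := Finset.card_pos.2 ⟨i, hi⟩
    norm_cast
    omega
  have hnode {θ : ℝ} (hθ : θ ∈ s) (k : ℝ) (hk : k ∈ s) :
      (Lagrange.basis s id k).eval θ = if k = θ then 1 else 0 := by
    split_ifs with h
    · subst h
      exact Lagrange.eval_basis_self (v := id) (injOn_id _) hk
    · exact Lagrange.eval_basis_of_ne (v := id) h hθ
  rw [integral_eval_eq_sum_gaussQuadrature hint horth hdeg, Finset.sum_congr rfl fun θ hθ ↦ by
    rw [eval_mul, hnode hθ i hi, hnode hθ j hj]]
  rcases eq_or_ne i j with rfl | hij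
  · simp [hi]
  · simp [hij]

variable {E : Type*} [NormedAddCommGroup E] [InnerProductSpace ℝ E]

lemma integral_norm_sum_basis_smul_sq (hint : ∀ f : ℝ[X], Integrable (fun x ↦ f.eval x) μ)
    (horth : IsOrthogonalPolynomial μ (Lagrange.nodal s id)) (u : ℝ → E) :
    ∫ t, ‖∑ θ ∈ s, (Lagrange.basis s id θ).eval t • u θ‖ ^ 2 ∂μ =
      ∑ θ ∈ s, (∫ x, (Lagrange.basis s id θ).eval x ∂μ) * ‖u θ‖ ^ 2 := by
  have hexpand (t : ℝ) : ‖∑ θ ∈ s, (Lagrange.basis s id θ).eval t • u θ‖ ^ 2 =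
      ∑ i ∈ s, ∑ j ∈ s,
        (Lagrange.basis s id i * Lagrange.basis s id j).eval t * inner ℝ (u j) (u i) := by
    simp only [← real_inner_self_eq_norm_sq, sum_inner, inner_sum, real_inner_smul_left,
      real_inner_smul_right, eval_mul, mul_assoc]
  simp only [hexpand]
  rw [integral_finsetSum _ fun i _ ↦ integrable_finsetSum _ fun j _ ↦ (hint _).mul_const _]
  refine Finset.sum_congr rfl fun i hi ↦ ?_
  rw [integral_finsetSum _ fun j _ ↦ (hint _).mul_const _]
  simp only [integral_mul_const]
  rw [Finset.sum_congr rfl fun j hj ↦ by rw [integral_eval_basis_mul_basis hint horth hi hj]]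
  simp [hi]

lemma integral_eval_basis_nonneg (hint : ∀ f : ℝ[X], Integrable (fun x ↦ f.eval x) μ)
    (horth : IsOrthogonalPolynomial μ (Lagrange.nodal s id)) {θ : ℝ} (hθ : θ ∈ s) :
    0 ≤ ∫ x, (Lagrange.basis s id θ).eval x ∂μ := by
  have hsq := integral_eval_basis_mul_basis hint horth hθ hθ
  rw [if_pos rfl] at hsq
  rw [← hsq]
  refine integral_nonneg fun x ↦ ?_
  rw [eval_mul]
  exact mul_self_nonneg _

lemma sum_integral_eval_basis (hint : ∀ f : ℝ[X], Integrable (fun x ↦ f.eval x) μ)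
    (hs : s.Nonempty) :
    ∑ θ ∈ s, ∫ x, (Lagrange.basis s id θ).eval x ∂μ = μ.real univ := by
  rw [← integral_finsetSum _ fun θ _ ↦ hint _]
  simp only [← eval_finsetSum, Lagrange.sum_basis (injOn_id _) hs]
  simp

lemma integral_norm_sum_basis_smul_sq_le (hint : ∀ f : ℝ[X], Integrable (fun x ↦ f.eval x) μ)
    (horth : IsOrthogonalPolynomial μ (Lagrange.nodal s id)) {u : ℝ → E} {B : ℝ}
    (hu : ∀ θ ∈ s, ‖u θ‖ ≤ B) :
    ∫ t, ‖∑ θ ∈ s, (Lagrange.basis s id θ).eval t • u θ‖ ^ 2 ∂μ ≤ μ.real univ * B ^ 2 := by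
  rw [integral_norm_sum_basis_smul_sq hint horth]
  rcases s.eq_empty_or_nonempty with rfl | hs
  · simp only [Finset.sum_empty]
    positivity
  rw [← sum_integral_eval_basis hint hs, Finset.sum_mul]
  gcongr with θ hθ
  · exact integral_eval_basis_nonneg hint horth hθ
  · exact hu θ hθ

end GaussQuadrature

section BernsteinApproximation

open Polynomial
open scoped unitInterval

variable {E : Type*} [NormedAddCommGroup E] [NormedSpace ℝ E] {K r : ℝ} {n : ℕ}

/-- By Jensen, `∑ bₖ(x) |x - k/n|ʳ ≤ (∑ bₖ(x) (x - k/n)²) ^ (r/2)`, and the sum on the right is the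
variance `x(1-x)/n`. -/
lemma norm_bernsteinApproximation_sub_le (hK : 0 ≤ K) (hr0 : 0 ≤ r) (hr2 : r ≤ 2) {f : C(I, E)}
    (hf : ∀ x y, dist (f x) (f y) ≤ K * dist x y ^ r) (hn : n ≠ 0) :
    ‖bernsteinApproximation n f - f‖ ≤ K * (1 / (4 * n)) ^ (r / 2) := by
  refine (ContinuousMap.norm_le _ (by positivity)).2 fun x ↦ ?_
  have hjensen := (Real.concaveOn_rpow (div_nonneg hr0 zero_le_two)
    (div_le_one_of_le₀ hr2 zero_le_two)).le_map_sum (t := Finset.univ)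
    (w := fun k : Fin (n + 1) ↦ bernstein n k x) (p := fun k ↦ (x - bernstein.z k : ℝ) ^ 2)
    (fun k _ ↦ bernstein_nonneg) (bernstein.probability n x) (fun k _ ↦ mem_Ici.2 (sq_nonneg _))
  have hvariance : ∑ k : Fin (n + 1), bernstein n k x * (x - bernstein.z k : ℝ) ^ 2 ≤
      1 / (4 * n) := by
    simp only [mul_comm (bernstein _ _ _), bernstein.variance hn, ← div_div]
    gcongr
    nlinarith [sq_nonneg ((x : ℝ) - 1 / 2)]
  have hdist (k : Fin (n + 1)) :
      ‖f (bernstein.z k) - f x‖ ≤ K * ((x - bernstein.z k : ℝ) ^ 2) ^ (r / 2) := by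
    rw [← sq_abs, ← Real.rpow_natCast_mul (abs_nonneg _), Nat.cast_ofNat,
      mul_div_cancel₀ _ two_ne_zero, ← dist_eq_norm, dist_comm]
    exact hf x (bernstein.z k)
  calc ‖(bernsteinApproximation n f - f) x‖
      = ‖∑ k : Fin (n + 1), bernstein n k x • (f (bernstein.z k) - f x)‖ := by
        simp only [smul_sub, Finset.sum_sub_distrib, ← Finset.sum_smul, bernstein.probability,
          one_smul, ContinuousMap.sub_apply, bernsteinApproximation.apply]
    _ ≤ ∑ k : Fin (n + 1), bernstein n k x * (K * ((x - bernstein.z k : ℝ) ^ 2) ^ (r / 2)) := by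
        refine norm_sum_le_of_le _ fun k _ ↦ ?_
        rw [norm_smul, Real.norm_of_nonneg bernstein_nonneg]
        gcongr
        exact hdist k
    _ = K * ∑ k : Fin (n + 1), bernstein n k x * ((x - bernstein.z k : ℝ) ^ 2) ^ (r / 2) := by
        simp only [mul_left_comm _ K, Finset.mul_sum]
    _ ≤ K * (1 / (4 * n)) ^ (r / 2) := by
        gcongr
        refine hjensen.trans ?_
        simp only [smul_eq_mul]
        gcongr

/-- The `E`-valued polynomials of degree less than `n` on `[a, b]`, as a subspace of `C([a, b], E)`;
they are the combinations of the monomials `p(t) • e` with `p : ℝ[X]` of degree less than `n`. -/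
def polynomialMaps (E : Type*) [NormedAddCommGroup E] [NormedSpace ℝ E] (a b : ℝ) (n : ℕ) :
    Submodule ℝ C(Icc a b, E) :=
  Submodule.span ℝ {f | ∃ p : ℝ[X], p.degree < n ∧ ∃ e : E, ∀ t, f t = p.eval (t : ℝ) • e}

lemma natDegree_bernsteinPolynomial_le {k : ℕ} (hk : k ≤ n) :
    (bernsteinPolynomial ℝ n k).natDegree ≤ n := by
  calc (bernsteinPolynomial ℝ n k).natDegree ≤ k + (n - k) * 1 := by
        rw [bernsteinPolynomial, mul_assoc, ← C_eq_natCast]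
        refine (natDegree_C_mul_le _ _).trans (natDegree_mul_le.trans ?_)
        gcongr
        · exact natDegree_X_pow_le k
        · exact natDegree_pow_le_of_le _ (by compute_degree)
    _ = n := by omega

lemma bernsteinApproximation_comp_mem_polynomialMaps {a b : ℝ} (hab : a < b) (f : C(I, E)) :
    (bernsteinApproximation n f).comp (iccHomeoI a b hab : C(Icc a b, I)) ∈
      polynomialMaps E a b (n + 1) := by
  have hsum : (bernsteinApproximation n f).comp (iccHomeoI a b hab : C(Icc a b, I)) =
      ∑ k : Fin (n + 1),
        ((bernstein n k).comp (iccHomeoI a b hab : C(Icc a b, I))) •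
          ContinuousMap.const _ (f (bernstein.z k)) := by
    ext t
    simp [bernsteinApproximation.apply]
  rw [hsum]
  refine Submodule.sum_mem _ fun k _ ↦ Submodule.subset_span
    ⟨(bernsteinPolynomial ℝ n k).comp (C (b - a)⁻¹ * (X - C a)), ?_, f (bernstein.z k),
      fun t ↦ ?_⟩
  · have hcomp : ((bernsteinPolynomial ℝ n k).comp (C (b - a)⁻¹ * (X - C a))).natDegree ≤ n * 1 :=
      natDegree_comp_le.trans
        (Nat.mul_le_mul (natDegree_bernsteinPolynomial_le k.is_le) (by compute_degree))
    exact degree_le_natDegree.trans_lt (by exact_mod_cast (by omega))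
  · simp [bernstein, div_eq_inv_mul]

lemma exists_mem_polynomialMaps_norm_sub_le {a b : ℝ} (hab : a < b) (hK : 0 ≤ K) (hr0 : 0 ≤ r)
    (hr2 : r ≤ 2) {f : C(Icc a b, E)} (hf : ∀ x y, dist (f x) (f y) ≤ K * dist x y ^ r)
    (hn : n ≠ 0) :
    ∃ g ∈ polynomialMaps E a b (n + 1),
      ‖g - f‖ ≤ K * (b - a) ^ r * (1 / (4 * n)) ^ (r / 2) := by
  have hba := sub_pos.2 hab
  let F : C(I, E) := f.comp ((iccHomeoI a b hab).symm : C(I, Icc a b))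
  have hF (x y : I) : dist (F x) (F y) ≤ K * (b - a) ^ r * dist x y ^ r := by
    have hdist : dist ((iccHomeoI a b hab).symm x) ((iccHomeoI a b hab).symm y) =
        (b - a) * dist x y := by
      rw [Subtype.dist_eq, Subtype.dist_eq, iccHomeoI_symm_apply_coe, iccHomeoI_symm_apply_coe,
        dist_add_right, Real.dist_eq, Real.dist_eq, ← mul_sub, abs_mul, abs_of_pos hba]
    rw [mul_assoc, ← Real.mul_rpow hba.le dist_nonneg, ← hdist]
    exact hf _ _
  refine ⟨_, bernsteinApproximation_comp_mem_polynomialMaps hab F,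
    (ContinuousMap.norm_le _ (by positivity)).2 fun t ↦ ?_⟩
  have happrox := norm_bernsteinApproximation_sub_le (by positivity) hr0 hr2 hF hn
  refine le_trans (Eq.trans_le ?_ ((bernsteinApproximation n F - F).norm_coe_le_norm
    (iccHomeoI a b hab t))) happrox
  simp [F]

end BernsteinApproximation

section WeakDerivative

variable {E : Type*} [NormedAddCommGroup E] {a b : ℝ}

lemma hasCompactSupport_of_tsupport_subset_Ioo {η : ℝ → E} (hη : tsupport η ⊆ Ioo a b) :
    HasCompactSupport η :=
  isCompact_Icc.of_isClosed_subset (isClosed_tsupport η) (hη.trans Ioo_subset_Icc_self)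

variable [NormedSpace ℝ E]

lemma integrable_smul_of_tsupport_subset_Ioo {μ : Measure ℝ} {η : ℝ → ℝ} {f : ℝ → E}
    (hη : Continuous η) (hsupp : tsupport η ⊆ Ioo a b) (hf : Integrable f μ) :
    Integrable (fun t ↦ η t • f t) μ := by
  obtain ⟨B, hB⟩ :=
    (hasCompactSupport_of_tsupport_subset_Ioo hsupp).exists_bound_of_continuous hη
  exact hf.bdd_smul B hη.aestronglyMeasurable (Eventually.of_forall hB)

lemma exists_subset_Icc_of_isCompact_of_subset_Ioo {s : Set ℝ} (hab : a < b) (hs : IsCompact s)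
    (hsab : s ⊆ Ioo a b) : ∃ a' b', a < a' ∧ b' < b ∧ s ⊆ Icc a' b' := by
  rcases s.eq_empty_or_nonempty with rfl | hne
  · exact ⟨b, a, hab, hab, empty_subset _⟩
  · obtain ⟨a', ha', hlower⟩ := hs.exists_isLeast hne
    obtain ⟨b', hb', hupper⟩ := hs.exists_isGreatest hne
    exact ⟨a', b', (hsab ha').1, (hsab hb').2, fun t ht ↦ ⟨hlower ht, hupper ht⟩⟩

lemma tsupport_integral_subset_Ioo {ξ : ℝ → E} (hab : a < b) (hξ : Continuous ξ)
    (hsupp : tsupport ξ ⊆ Ioo a b) (hint : ∫ t in a..b, ξ t = 0) :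
    tsupport (fun x ↦ ∫ t in a..x, ξ t) ⊆ Ioo a b := by
  obtain ⟨a', b', ha', hb', hsub⟩ := exists_subset_Icc_of_isCompact_of_subset_Ioo hab
    (hasCompactSupport_of_tsupport_subset_Ioo hsupp) hsupp
  have hzero {t : ℝ} (ht : t ∉ Icc a' b') : ξ t = 0 :=
    image_eq_zero_of_notMem_tsupport fun h ↦ ht (hsub h)
  suffices hprimitive : tsupport (fun x ↦ ∫ t in a..x, ξ t) ⊆ Icc a' b' from
    hprimitive.trans (Icc_subset_Ioo ha' hb')
  refine closure_minimal (fun x hx ↦ ?_) isClosed_Icc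
  by_contra hxab
  refine hx ?_
  rcases lt_or_ge x a' with hlt | hge
  · exact intervalIntegral.integral_zero_ae (Eventually.of_forall fun t ht ↦
      hzero fun h ↦ (ht.2.trans_lt (max_lt ha' hlt)).not_ge h.1)
  · have hgt : b' < x := not_le.1 fun hle ↦ hxab ⟨hge, hle⟩
    change ∫ t in a..x, ξ t = 0
    rw [← intervalIntegral.integral_add_adjacent_intervals (hξ.intervalIntegrable a b)
      (hξ.intervalIntegrable b x), hint, zero_add]
    exact intervalIntegral.integral_zero_ae (Eventually.of_forall fun t ht ↦
      hzero fun h ↦ ((lt_min hb' hgt).trans ht.1).not_ge h.2)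

lemma exists_deriv_eq_of_integral_eq_zero [CompleteSpace E] {ξ : ℝ → E}
    (hab : a < b) (hξ : ContDiff ℝ ∞ ξ) (hsupp : tsupport ξ ⊆ Ioo a b)
    (hint : ∫ t in a..b, ξ t = 0) :
    ∃ ζ : ℝ → E, ContDiff ℝ ∞ ζ ∧ tsupport ζ ⊆ Ioo a b ∧ deriv ζ = ξ := by
  have hderiv (x : ℝ) : HasDerivAt (fun x ↦ ∫ t in a..x, ξ t) (ξ x) x :=
    intervalIntegral.integral_hasDerivAt_right (hξ.continuous.intervalIntegrable _ _)
      (hξ.continuous.stronglyMeasurableAtFilter _ _) hξ.continuous.continuousAt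
  have hderiv_eq : deriv (fun x ↦ ∫ t in a..x, ξ t) = ξ := funext fun x ↦ (hderiv x).deriv
  exact ⟨fun x ↦ ∫ t in a..x, ξ t,
    contDiff_infty_iff_deriv.2 ⟨fun x ↦ (hderiv x).differentiableAt, hderiv_eq.symm ▸ hξ⟩,
    tsupport_integral_subset_Ioo hab hξ.continuous hsupp hint, hderiv_eq⟩

lemma exists_contDiff_tsupport_subset_integral_eq_one (hab : a < b) :
    ∃ ψ : ℝ → ℝ, ContDiff ℝ ∞ ψ ∧ tsupport ψ ⊆ Ioo a b ∧ ∫ t in Icc a b, ψ t = 1 := by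
  let ψ : ContDiffBump ((a + b) / 2) :=
    { rIn := (b - a) / 8, rOut := (b - a) / 4, rIn_pos := by linarith, rIn_lt_rOut := by linarith }
  have hsupp : tsupport (ψ.normed volume) ⊆ Ioo a b := by
    rw [ψ.tsupport_normed_eq, Real.closedBall_eq_Icc]
    exact Icc_subset_Ioo (by simp only [ψ]; linarith) (by simp only [ψ]; linarith)
  refine ⟨ψ.normed volume, ψ.contDiff_normed, hsupp, ?_⟩
  rw [← ψ.integral_normed (μ := volume)]
  exact setIntegral_eq_integral_of_forall_compl_eq_zero fun x hx ↦
    image_eq_zero_of_notMem_tsupport fun hx' ↦ hx (Ioo_subset_Icc_self (hsupp hx'))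

lemma exists_deriv_eq_sub_integral_mul {ψ η : ℝ → ℝ} (hab : a < b) (hψ : ContDiff ℝ ∞ ψ)
    (hψsupp : tsupport ψ ⊆ Ioo a b) (hψint : ∫ t in Icc a b, ψ t = 1) (hη : ContDiff ℝ ∞ η)
    (hηsupp : tsupport η ⊆ Ioo a b) :
    ∃ ζ : ℝ → ℝ, ContDiff ℝ ∞ ζ ∧ tsupport ζ ⊆ Ioo a b ∧
      ∀ t, deriv ζ t = η t - (∫ t in Icc a b, η t) * ψ t := by
  obtain ⟨ζ, hζ, hζsupp, hderiv⟩ := exists_deriv_eq_of_integral_eq_zero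
    (ξ := fun t ↦ η t - (∫ t in Icc a b, η t) * ψ t) hab (hη.sub (contDiff_const.mul hψ))
    ((tsupport_sub η _).trans (union_subset hηsupp (tsupport_mul_subset_right.trans hψsupp))) <| by
      rw [intervalIntegral.integral_of_le hab.le, ← integral_Icc_eq_integral_Ioc,
        integral_sub hη.continuous.integrableOn_Icc
          (hψ.continuous.integrableOn_Icc.const_mul _),
        integral_const_mul, hψint, mul_one, sub_self]
  exact ⟨ζ, hζ, hζsupp, congrFun hderiv⟩

/-- The lemma of du Bois-Reymond: every test function is the derivative of another one up to a
multiple of a fixed test function of integral `1`. -/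
lemma ae_eq_const_of_integral_deriv_smul_eq_zero [CompleteSpace E] (hab : a < b) {f : ℝ → E}
    (hf : IntegrableOn f (Icc a b))
    (horth : ∀ η : ℝ → ℝ, ContDiff ℝ ∞ η → tsupport η ⊆ Ioo a b →
      ∫ t in Icc a b, deriv η t • f t = 0) :
    ∃ c : E, f =ᵐ[volume.restrict (Icc a b)] fun _ ↦ c := by
  obtain ⟨ψ, hψ, hψsupp, hψint⟩ := exists_contDiff_tsupport_subset_integral_eq_one hab
  set c := ∫ t in Icc a b, ψ t • f t
  have hsmul {η : ℝ → ℝ} (hη : ContDiff ℝ ∞ η) (hηsupp : tsupport η ⊆ Ioo a b) :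
      IntegrableOn (fun t ↦ η t • f t) (Icc a b) :=
    integrable_smul_of_tsupport_subset_Ioo hη.continuous hηsupp hf.integrable
  have hzero : ∀ᵐ t ∂volume.restrict (Icc a b), t ∈ Ioo a b → f t - c = 0 := by
    refine isOpen_Ioo.ae_eq_zero_of_integral_contDiff_smul_eq_zero
      ((hf.sub (integrable_const c)).locallyIntegrable.locallyIntegrableOn _)
      fun η hη _ hηsupp ↦ ?_
    obtain ⟨ζ, hζ, hζsupp, hderiv⟩ :=
      exists_deriv_eq_sub_integral_mul hab hψ hψsupp hψint hη hηsupp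
    have hζf := horth ζ hζ hζsupp
    simp_rw [hderiv, sub_smul, mul_smul] at hζf
    rw [integral_sub (hsmul hη hηsupp) ((hsmul hψ hψsupp).fun_smul _), integral_smul] at hζf
    simp_rw [smul_sub]
    rw [integral_sub (hsmul hη hηsupp) (hη.continuous.integrableOn_Icc.smul_const c),
      integral_smul_const, hζf]
  rw [← restrict_Ioo_eq_restrict_Icc] at hzero ⊢
  refine ⟨c, ?_⟩
  filter_upwards [hzero, ae_restrict_mem measurableSet_Ioo] with t ht hmem
  exact sub_eq_zero.1 (ht hmem)

end WeakDerivative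

section Primitive

variable {E : Type*} [NormedAddCommGroup E] {a b : ℝ}

lemma intervalIntegrable_left_of_mem_Icc {g : ℝ → E} (hg : IntegrableOn g (Icc a b)) {t : ℝ}
    (ht : t ∈ Icc a b) : IntervalIntegrable g volume a t :=
  (intervalIntegrable_iff_integrableOn_Icc_of_le ht.1).2 (hg.mono_set (Icc_subset_Icc_right ht.2))

variable [NormedSpace ℝ E]

lemma integral_deriv_mul_primitive (hab : a ≤ b) {g η : ℝ → ℝ} (hg : IntegrableOn g (Icc a b))
    (hη : ContDiff ℝ ∞ η) (hsupp : tsupport η ⊆ Ioo a b) :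
    ∫ t in Icc a b, deriv η t * ∫ r in a..t, g r = -∫ t in Icc a b, η t * g t := by
  have hgi : IntervalIntegrable g volume a b :=
    (intervalIntegrable_iff_integrableOn_Icc_of_le hab).2 hg
  have hparts := (hgi.absolutelyContinuousOnInterval_intervalIntegral
    (c := a) left_mem_uIcc).integral_mul_deriv_eq_deriv_mul
      ((hη.of_le (by simp)).contDiffOn (s := uIcc a b)).absolutelyContinuousOnInterval
  have ha : η a = 0 := image_eq_zero_of_notMem_tsupport fun h ↦ lt_irrefl _ (hsupp h).1
  have hb : η b = 0 := image_eq_zero_of_notMem_tsupport fun h ↦ lt_irrefl _ (hsupp h).2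
  rw [ha, hb, mul_zero, mul_zero, sub_zero, zero_sub] at hparts
  rw [integral_Icc_eq_integral_Ioc, integral_Icc_eq_integral_Ioc,
    ← intervalIntegral.integral_of_le hab, ← intervalIntegral.integral_of_le hab]
  simp_rw [mul_comm (deriv η _)]
  rw [hparts]
  congr 1
  refine intervalIntegral.integral_congr_ae ?_
  filter_upwards [hgi.ae_hasDerivAt_integral] with t ht htm
  rw [(ht (uIoc_subset_uIcc htm) a left_mem_uIcc).deriv, mul_comm]

lemma continuousOn_primitive_Icc (hab : a ≤ b) {g : ℝ → E} (hg : IntegrableOn g (Icc a b)) :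
    ContinuousOn (fun t ↦ ∫ r in a..t, g r) (Icc a b) := by
  rw [← uIcc_of_le hab] at hg ⊢
  exact intervalIntegral.continuousOn_primitive_interval hg

lemma integral_deriv_smul_primitive [CompleteSpace E] (hab : a ≤ b) {g : ℝ → E} {η : ℝ → ℝ}
    (hg : IntegrableOn g (Icc a b)) (hη : ContDiff ℝ ∞ η) (hsupp : tsupport η ⊆ Ioo a b) :
    ∫ t in Icc a b, deriv η t • ∫ r in a..t, g r = -∫ t in Icc a b, η t • g t := by
  have hderiv : IntegrableOn (fun t ↦ deriv η t • ∫ r in a..t, g r) (Icc a b) :=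
    ((hη.continuous_deriv (by simp)).continuousOn.smul
      (continuousOn_primitive_Icc hab hg)).integrableOn_Icc
  have hηg : IntegrableOn (fun t ↦ η t • g t) (Icc a b) :=
    integrable_smul_of_tsupport_subset_Ioo hη.continuous hsupp hg.integrable
  refine (SeparatingDual.eq_iff_forall_dual_eq (R := ℝ)).2 fun L ↦ ?_
  rw [map_neg, ← L.integral_comp_comm hderiv, ← L.integral_comp_comm hηg]
  simp only [map_smul, smul_eq_mul]
  rw [← integral_deriv_mul_primitive hab (L.integrable_comp hg) hη hsupp]
  refine setIntegral_congr_fun measurableSet_Icc fun t ht ↦ ?_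
  simp only [← L.intervalIntegral_comp_comm (intervalIntegrable_left_of_mem_Icc hg ht)]

end Primitive

section ContinuousRepresentative

variable {E : Type*} [NormedAddCommGroup E] {p : ℝ≥0∞} [Fact (1 ≤ p)] {a b : ℝ}

lemma setIntegral_norm_le_norm_mul_rpow {α : Type*} [MeasurableSpace α] {μ : Measure α}
    (f : Lp E p μ) {s : Set α} (hs : μ s ≠ ⊤) :
    ∫ t in s, ‖f t‖ ∂μ ≤ ‖f‖ * μ.real s ^ (1 - p.toReal⁻¹) := by
  have hf : MemLp f p (μ.restrict s) := (Lp.memLp f).restrict s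
  have hone : eLpNorm f 1 (μ.restrict s) ≤ eLpNorm f p μ * μ s ^ (1 - p.toReal⁻¹) := by
    refine (eLpNorm_le_eLpNorm_mul_rpow_measure_univ (p := 1) (q := p) Fact.out hf.1).trans ?_
    rw [Measure.restrict_apply_univ, ENNReal.toReal_one, div_one, one_div]
    gcongr
    exact Measure.restrict_le_self
  have hp : p.toReal⁻¹ ≤ 1 := by
    rw [← ENNReal.toReal_inv]
    exact ENNReal.toReal_mono ENNReal.one_ne_top (ENNReal.inv_le_one.2 Fact.out)
  rw [integral_norm_eq_lintegral_enorm hf.1, ← eLpNorm_one_eq_lintegral_enorm, Lp.norm_def,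
    measureReal_def, ENNReal.toReal_rpow, ← ENNReal.toReal_mul]
  exact ENNReal.toReal_mono (ENNReal.mul_ne_top (Lp.eLpNorm_ne_top f)
    (ENNReal.rpow_ne_top_of_nonneg (sub_nonneg.2 hp) hs)) hone

variable [NormedSpace ℝ E]

/-- The class in `Lᵖ([a, b], E)` of a continuous function on `[a, b]`. -/
noncomputable def iccToLp (E : Type*) [NormedAddCommGroup E] [NormedSpace ℝ E] (p : ℝ≥0∞)
    [Fact (1 ≤ p)] (hab : a ≤ b) : C(Icc a b, E) →L[ℝ] Lp E p (volume.restrict (Icc a b)) :=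
  (Lp.compMeasurePreservingₗᵢ ℝ (projIcc a b hab)
    (continuous_projIcc.measurable.measurePreserving _)).toContinuousLinearMap ∘L
      ContinuousMap.toLp p ((volume.restrict (Icc a b)).map (projIcc a b hab)) ℝ

lemma iccToLp_ae_eq (hab : a ≤ b) (f : C(Icc a b, E)) :
    iccToLp E p hab f =ᵐ[volume.restrict (Icc a b)] IccExtend hab f :=
  have hproj : MeasurePreserving (projIcc a b hab) (volume.restrict (Icc a b)) _ :=
    continuous_projIcc.measurable.measurePreserving _
  (Lp.coeFn_compMeasurePreserving _ hproj).trans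
    (hproj.quasiMeasurePreserving.ae_eq_comp (ContinuousMap.coeFn_toLp _ f))

lemma iccToLp_injective (hab : a < b) : Function.Injective (iccToLp E p hab.le) := by
  intro f g hfg
  have hext : EqOn (IccExtend hab.le f) (IccExtend hab.le g) (Icc a b) :=
    Measure.eqOn_Icc_of_ae_eq volume hab.ne
      ((iccToLp_ae_eq hab.le f).symm.trans (hfg ▸ iccToLp_ae_eq hab.le g))
      f.continuous.Icc_extend'.continuousOn g.continuous.Icc_extend'.continuousOn
  ext t
  simpa only [IccExtend_val] using hext t.2

lemma norm_iccToLp_le (hab : a ≤ b) : ‖iccToLp E p hab‖ ≤ (b - a) ^ p.toReal⁻¹ := by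
  rw [iccToLp, LinearIsometry.norm_toContinuousLinearMap_comp]
  refine (ContinuousMap.toLp_norm_le _).trans_eq ?_
  change ((volume.restrict (Icc a b)).map (projIcc a b hab)).real univ ^ p.toReal⁻¹ = _
  rw [map_measureReal_apply continuous_projIcc.measurable .univ, preimage_univ,
    measureReal_restrict_apply_univ, Real.volume_real_Icc_of_le hab]

lemma norm_le_of_forall_dist_le (hab : a < b) {f : C(Icc a b, E)} {D : ℝ}
    (hD : ∀ x y, dist (f x) (f y) ≤ D) :
    ‖f‖ ≤ (b - a)⁻¹ * (‖iccToLp E p hab.le f‖ * (b - a) ^ (1 - p.toReal⁻¹)) + D := by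
  have : 0 < b - a := sub_pos.2 hab
  have hvol : volume.real (Icc a b) = b - a := Real.volume_real_Icc_of_le hab.le
  obtain ⟨y, hy, hfy⟩ := exists_le_setAverage (f := fun t ↦ ‖IccExtend hab.le f t‖)
    (μ := volume) (s := Icc a b) (by simpa using hab) (by simp)
    f.continuous.Icc_extend'.norm.integrableOn_Icc
  have haverage : ⨍ t in Icc a b, ‖IccExtend hab.le f t‖ ≤
      (b - a)⁻¹ * (‖iccToLp E p hab.le f‖ * (b - a) ^ (1 - p.toReal⁻¹)) := by
    have hle := setIntegral_norm_le_norm_mul_rpow (iccToLp E p hab.le f) (measure_ne_top _ univ)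
    rw [Measure.restrict_univ, measureReal_restrict_apply_univ, hvol] at hle
    rw [setAverage_eq, hvol, smul_eq_mul]
    gcongr
    exact (integral_congr_ae ((iccToLp_ae_eq hab.le f).fun_comp norm)).symm.trans_le hle
  rw [IccExtend_of_mem _ _ hy] at hfy
  have : Nonempty (Icc a b) := ⟨⟨y, hy⟩⟩
  refine (ContinuousMap.norm_le_of_nonempty f).2 fun x ↦ ?_
  calc ‖f x‖ ≤ ‖f ⟨y, hy⟩‖ + ‖f x - f ⟨y, hy⟩‖ := norm_le_norm_add_norm_sub' _ _
    _ ≤ _ := add_le_add (hfy.trans haverage) (dist_eq_norm (f x) _ ▸ hD x ⟨y, hy⟩)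

end ContinuousRepresentative

section Sobolev

variable {d : ℕ} {a b : ℝ}

lemma dist_primitive_le {E : Type*} [NormedAddCommGroup E] [NormedSpace ℝ E] {p : ℝ≥0∞}
    [Fact (1 ≤ p)] (g : Lp E p (volume.restrict (Icc a b))) {x y : ℝ} (hx : x ∈ Icc a b)
    (hy : y ∈ Icc a b) :
    dist (∫ r in a..x, g r) (∫ r in a..y, g r) ≤ ‖g‖ * dist x y ^ (1 - p.toReal⁻¹) := by
  have hg : IntegrableOn g (Icc a b) := (Lp.memLp g).integrable Fact.out
  rw [dist_eq_norm, intervalIntegral.integral_interval_sub_left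
    (intervalIntegrable_left_of_mem_Icc hg hx) (intervalIntegrable_left_of_mem_Icc hg hy)]
  refine intervalIntegral.norm_integral_le_integral_norm_uIoc.trans ?_
  have hsub : uIoc y x ⊆ Icc a b := uIoc_subset_uIcc.trans (uIcc_subset_Icc hy hx)
  have hle := setIntegral_norm_le_norm_mul_rpow g (s := uIoc y x) (measure_ne_top _ _)
  rwa [Measure.restrict_restrict_of_subset hsub, measureReal_restrict_apply measurableSet_uIoc,
    inter_eq_self_of_subset_left hsub, measureReal_def, Real.volume_uIoc,
    ENNReal.toReal_ofReal (abs_nonneg _)] at hle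

lemma IsWeakDeriv.exists_ae_eq_const_add_primitive (hab : a < b) {f g : L2 d a b}
    (hfg : IsWeakDeriv f g) :
    ∃ c : Vec d, f =ᵐ[volume.restrict (Icc a b)] fun t ↦ c + ∫ r in a..t, g r := by
  have hf : IntegrableOn f (Icc a b) := (Lp.memLp f).integrable one_le_two
  have hg : IntegrableOn g (Icc a b) := (Lp.memLp g).integrable one_le_two
  have hprim := continuousOn_primitive_Icc hab.le hg
  obtain ⟨c, hc⟩ := ae_eq_const_of_integral_deriv_smul_eq_zero hab
    (f := fun t ↦ f t - ∫ r in a..t, g r) (hf.sub hprim.integrableOn_Icc) fun η hη hsupp ↦ by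
      have hcompact := hasCompactSupport_of_tsupport_subset_Ioo hsupp
      have hderiv := hη.continuous_deriv (by simp)
      simp_rw [smul_sub]
      rw [integral_sub (integrable_smul_L2 f hderiv hcompact.deriv)
        (hderiv.continuousOn.fun_smul hprim).integrableOn_Icc,
        integral_deriv_smul_primitive hab.le hg hη hsupp, hfg η hη hcompact hsupp, sub_self]
  refine ⟨c, ?_⟩
  filter_upwards [hc] with t ht
  rw [← ht, sub_add_cancel]

lemma IsWeakDeriv.exists_holder (hab : a < b) {f g : L2 d a b} (hfg : IsWeakDeriv f g) :
    ∃ u : C(Icc a b, Vec d), iccToLp (Vec d) 2 hab.le u = f ∧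
      ∀ x y, dist (u x) (u y) ≤ ‖g‖ * dist x y ^ (1 / 2 : ℝ) := by
  have hg : IntegrableOn g (Icc a b) := (Lp.memLp g).integrable one_le_two
  obtain ⟨c, hc⟩ := hfg.exists_ae_eq_const_add_primitive hab
  let u : C(Icc a b, Vec d) := ⟨fun t ↦ c + ∫ r in a..t, g r, continuous_const.add
    (continuousOn_iff_continuous_domRestrict.1 (continuousOn_primitive_Icc hab.le hg))⟩
  refine ⟨u, Lp.ext ?_, fun x y ↦ ?_⟩
  · filter_upwards [iccToLp_ae_eq (p := 2) hab.le u, hc, ae_restrict_mem measurableSet_Icc]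
      with t hu ht hmem
    rw [hu, ht, IccExtend_of_mem _ _ hmem]
    rfl
  · have hle := dist_primitive_le g x.2 y.2
    norm_num at hle
    simpa [u, Subtype.dist_eq] using hle

/-- The embedding of `H¹` into `L²`. -/
noncomputable def H1.toL2CLM (d : ℕ) (a b : ℝ) : H1 d a b →L[ℝ] L2 d a b :=
  WithLp.fstL 2 ℝ (L2 d a b) (L2 d a b) ∘L (H1 d a b).subtypeL

lemma H1.exists_holder (hab : a < b) (p : H1 d a b) :
    ∃ u : C(Icc a b, Vec d), iccToLp (Vec d) 2 hab.le u = H1.toL2 p ∧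
      ∀ x y, dist (u x) (u y) ≤ ‖p‖ * dist x y ^ (1 / 2 : ℝ) := by
  obtain ⟨u, hu, hholder⟩ := IsWeakDeriv.exists_holder hab p.2
  refine ⟨u, hu, fun x y ↦ (hholder x y).trans ?_⟩
  gcongr
  exact WithLp.norm_snd_le _ p.1

/-- The continuous representative of an element of `H¹`, as a linear map. -/
noncomputable def H1.toContinuousₗ (hab : a < b) : H1 d a b →ₗ[ℝ] C(Icc a b, Vec d) :=
  (LinearEquiv.ofInjective (iccToLp (Vec d) 2 hab.le).toLinearMap
    (iccToLp_injective hab)).symm.toLinearMap ∘ₗ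
    (H1.toL2CLM d a b).toLinearMap.codRestrict _ fun p ↦
      (H1.exists_holder hab p).imp fun _ hu ↦ hu.1

lemma iccToLp_toContinuousₗ (hab : a < b) (p : H1 d a b) :
    iccToLp (Vec d) 2 hab.le (H1.toContinuousₗ hab p) = H1.toL2 p :=
  congrArg Subtype.val (LinearEquiv.apply_symm_apply (LinearEquiv.ofInjective
    (iccToLp (Vec d) 2 hab.le).toLinearMap (iccToLp_injective hab)) _)

lemma dist_toContinuousₗ_le (hab : a < b) (p : H1 d a b) (x y : Icc a b) :
    dist (H1.toContinuousₗ hab p x) (H1.toContinuousₗ hab p y) ≤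
      ‖p‖ * dist x y ^ (1 / 2 : ℝ) := by
  obtain ⟨u, hu, hholder⟩ := H1.exists_holder hab p
  rw [← iccToLp_injective hab (hu.trans (iccToLp_toContinuousₗ hab p).symm)]
  exact hholder x y

lemma norm_toContinuousₗ_le (hab : a < b) (p : H1 d a b) :
    ‖H1.toContinuousₗ hab p‖ ≤
      ((b - a)⁻¹ * (b - a) ^ (1 / 2 : ℝ) + (b - a) ^ (1 / 2 : ℝ)) * ‖p‖ := by
  have : 0 < b - a := sub_pos.2 hab
  have hle := norm_le_of_forall_dist_le (p := 2) hab (D := ‖p‖ * (b - a) ^ (1 / 2 : ℝ))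
    fun x y ↦ (dist_toContinuousₗ_le hab p x y).trans <| by
      gcongr
      exact Real.dist_le_of_mem_Icc x.2 y.2
  have hexponent : 1 - (2 : ℝ≥0∞).toReal⁻¹ = 1 / 2 := by norm_num
  rw [iccToLp_toContinuousₗ, hexponent] at hle
  have hnorm : ‖H1.toL2 p‖ ≤ ‖p‖ := WithLp.norm_fst_le _ p.1
  calc ‖H1.toContinuousₗ hab p‖
      ≤ (b - a)⁻¹ * (‖p‖ * (b - a) ^ (1 / 2 : ℝ)) + ‖p‖ * (b - a) ^ (1 / 2 : ℝ) := by
        refine hle.trans ?_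
        gcongr
    _ = _ := by ring

/-- The continuous representative of an element of `H¹`. -/
noncomputable def H1.toContinuous (hab : a < b) : H1 d a b →L[ℝ] C(Icc a b, Vec d) :=
  (H1.toContinuousₗ hab).mkContinuous _ (norm_toContinuousₗ_le hab)

lemma iccToLp_toContinuous (hab : a < b) (p : H1 d a b) :
    iccToLp (Vec d) 2 hab.le (H1.toContinuous hab p) = H1.toL2 p :=
  iccToLp_toContinuousₗ hab p

lemma dist_toContinuous_le (hab : a < b) (p : H1 d a b) (x y : Icc a b) :
    dist (H1.toContinuous hab p x) (H1.toContinuous hab p y) ≤ ‖p‖ * dist x y ^ (1 / 2 : ℝ) :=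
  dist_toContinuousₗ_le hab p x y

end Sobolev

section Interpolation

open Polynomial

variable {E : Type*} [NormedAddCommGroup E] [NormedSpace ℝ E] {a b : ℝ} {s : Finset ℝ}

/-- Lagrange interpolation of continuous functions on `[a, b]` at the nodes `s`, which are meant to
lie in `[a, b]`: a node outside is replaced by the nearest endpoint when `f` is evaluated. -/
noncomputable def interpolate (E : Type*) [NormedAddCommGroup E] [NormedSpace ℝ E] (hab : a ≤ b)
    (s : Finset ℝ) : C(Icc a b, E) →L[ℝ] C(Icc a b, E) where
  toFun f := ⟨fun t ↦ ∑ θ ∈ s, (Lagrange.basis s id θ).eval (t : ℝ) • IccExtend hab f θ,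
    by fun_prop⟩
  map_add' f g := by
    ext t
    simp [IccExtend, smul_add, Finset.sum_add_distrib]
  map_smul' c f := by
    ext t
    simp [IccExtend, Finset.smul_sum, smul_comm c]
  cont := ContinuousMap.continuous_of_continuous_uncurry _ <| by
    simp only [Function.uncurry_def, IccExtend, Function.comp_apply, ContinuousMap.coe_mk]
    fun_prop

lemma interpolate_apply (hab : a ≤ b) (f : C(Icc a b, E)) (t : Icc a b) :
    interpolate E hab s f t =
      ∑ θ ∈ s, (Lagrange.basis s id θ).eval (t : ℝ) • IccExtend hab f θ := rfl

lemma interpolate_eq_self_of_mem_polynomialMaps (hab : a ≤ b) (hs : ↑s ⊆ Icc a b)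
    {f : C(Icc a b, E)} (hf : f ∈ polynomialMaps E a b s.card) : interpolate E hab s f = f := by
  refine LinearMap.eqOn_span (f := (interpolate E hab s).toLinearMap) (g := LinearMap.id) ?_ hf
  rintro g ⟨p, hp, e, hg⟩
  ext t
  calc interpolate E hab s g t
      = ∑ θ ∈ s, (Lagrange.basis s id θ).eval (t : ℝ) • p.eval θ • e := by
        rw [interpolate_apply]
        refine Finset.sum_congr rfl fun θ hθ ↦ ?_
        rw [IccExtend_of_mem _ _ (hs hθ), hg]
    _ = (Lagrange.interpolate s id fun θ ↦ p.eval θ).eval (t : ℝ) • e := by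
        simp only [Lagrange.interpolate_apply, eval_finsetSum, Finset.sum_smul, eval_mul, eval_C,
          smul_smul, mul_comm]
    _ = g t := by
        have hinterp : p = Lagrange.interpolate s id fun θ ↦ p.eval θ :=
          Lagrange.eq_interpolate_of_eval_eq _ (injOn_id _) hp fun _ _ ↦ rfl
        rw [← hinterp, hg]

end Interpolation

section GaussianInterpolation

variable {E : Type*} [NormedAddCommGroup E] [InnerProductSpace ℝ E] {a b : ℝ} {s : Finset ℝ}

lemma norm_sq_eq_integral_norm_sq {α : Type*} [MeasurableSpace α] {μ : Measure α}
    (f : Lp E 2 μ) : ‖f‖ ^ 2 = ∫ t, ‖f t‖ ^ 2 ∂μ := by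
  simp only [← real_inner_self_eq_norm_sq, L2.inner_def]

/-- Erdős–Turán stability: the Gauss weights are nonnegative and sum to `b - a`. -/
lemma norm_iccToLp_interpolate_le (hab : a ≤ b)
    (horth : IsOrthogonalPolynomial (volume.restrict (Icc a b)) (Lagrange.nodal s id))
    (f : C(Icc a b, E)) :
    ‖iccToLp E 2 hab (interpolate E hab s f)‖ ≤ √(b - a) * ‖f‖ := by
  have hsq := integral_norm_sum_basis_smul_sq_le (fun p ↦ integrableOn_eval_Icc p a b) horth
    (u := IccExtend hab f) (B := ‖f‖) fun θ _ ↦ f.norm_coe_le_norm _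
  rw [measureReal_restrict_apply_univ, Real.volume_real_Icc_of_le hab] at hsq
  refine le_of_sq_le_sq ?_ (by positivity)
  rw [mul_pow, Real.sq_sqrt (sub_nonneg.2 hab), norm_sq_eq_integral_norm_sq]
  refine (integral_congr_ae ?_).trans_le hsq
  filter_upwards [iccToLp_ae_eq (p := 2) hab (interpolate E hab s f),
    ae_restrict_mem measurableSet_Icc] with t ht hmem
  rw [ht, IccExtend_of_mem _ _ hmem, interpolate_apply]

lemma norm_iccToLp_interpolate_sub_le (hab : a ≤ b) (hs : ↑s ⊆ Icc a b)
    (horth : IsOrthogonalPolynomial (volume.restrict (Icc a b)) (Lagrange.nodal s id))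
    (f : C(Icc a b, E)) {g : C(Icc a b, E)} (hg : g ∈ polynomialMaps E a b s.card) :
    ‖iccToLp E 2 hab (interpolate E hab s f) - iccToLp E 2 hab f‖ ≤ 2 * √(b - a) * ‖g - f‖ := by
  have hdecomp : iccToLp E 2 hab (interpolate E hab s f) - iccToLp E 2 hab f =
      iccToLp E 2 hab (g - f) - iccToLp E 2 hab (interpolate E hab s (g - f)) := by
    simp only [map_sub, interpolate_eq_self_of_mem_polynomialMaps hab hs hg]
    abel
  have hembed : ‖iccToLp E 2 hab (g - f)‖ ≤ √(b - a) * ‖g - f‖ := by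
    refine (iccToLp E 2 hab).le_of_opNorm_le ((norm_iccToLp_le hab).trans_eq ?_) _
    rw [Real.sqrt_eq_rpow]
    norm_num
  calc _ ≤ ‖iccToLp E 2 hab (g - f)‖ + ‖iccToLp E 2 hab (interpolate E hab s (g - f))‖ :=
        hdecomp ▸ norm_sub_le _ _
    _ ≤ √(b - a) * ‖g - f‖ + √(b - a) * ‖g - f‖ :=
        add_le_add hembed (norm_iccToLp_interpolate_le hab horth _)
    _ = 2 * √(b - a) * ‖g - f‖ := by ring

variable {d : ℕ} {h : ℝ}

/-- `𝓛_N`, as an operator from `H¹` to `L²`. -/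
noncomputable def legendreInterp (d : ℕ) (hh : 0 < h) (N : ℕ) : H1 d 0 h →L[ℝ] L2 d 0 h :=
  iccToLp (Vec d) 2 hh.le ∘L interpolate (Vec d) hh.le (nodes h N) ∘L H1.toContinuous hh

lemma legendreInterp_ae_eq (hh : 0 < h) (N : ℕ) {p : H1 d 0 h} {u : ℝ → Vec d}
    (hu : ContinuousOn u (Icc 0 h)) (hup : u =ᵐ[volume.restrict (Icc 0 h)] H1.toL2 p) :
    legendreInterp d hh N p =ᵐ[volume.restrict (Icc 0 h)] lagrangeInterp h N u := by
  have hrep : EqOn (IccExtend hh.le (H1.toContinuous hh p)) u (Icc 0 h) :=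
    Measure.eqOn_Icc_of_ae_eq volume hh.ne
      ((iccToLp_ae_eq hh.le _).symm.trans (iccToLp_toContinuous hh p ▸ hup.symm))
      (H1.toContinuous hh p).continuous.Icc_extend'.continuousOn hu
  filter_upwards [iccToLp_ae_eq (p := 2) hh.le
    (interpolate (Vec d) hh.le (nodes h N) (H1.toContinuous hh p)),
    ae_restrict_mem measurableSet_Icc] with t ht hmem
  refine ht.trans ?_
  rw [IccExtend_of_mem _ _ hmem, interpolate_apply, lagrangeInterp]
  exact Finset.sum_congr rfl fun θ hθ ↦ by rw [hrep (nodes_subset_Icc hh N hθ)]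

lemma norm_legendreInterp_sub_le (hh : 0 < h) {n : ℕ} (hn : n ≠ 0) :
    ‖legendreInterp d hh (n + 1) - H1.toL2CLM d 0 h‖ ≤
      2 * √h * (h ^ (1 / 2 : ℝ) * (1 / (4 * n)) ^ (1 / 4 : ℝ)) := by
  refine ContinuousLinearMap.opNorm_le_bound _ (by positivity) fun p ↦ ?_
  obtain ⟨g, hg, hgp⟩ := exists_mem_polynomialMaps_norm_sub_le hh (norm_nonneg p)
    (r := 1 / 2) (by norm_num) (by norm_num) (dist_toContinuous_le hh p) hn
  rw [← card_nodes hh (n + 1)] at hg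
  have hle := norm_iccToLp_interpolate_sub_le hh.le (nodes_subset_Icc hh _)
    (isOrthogonalPolynomial_nodal_nodes hh _) (H1.toContinuous hh p) hg
  rw [iccToLp_toContinuous, sub_zero] at hle
  refine hle.trans ((mul_le_mul_of_nonneg_left hgp (by positivity)).trans_eq ?_)
  rw [sub_zero]
  norm_num
  ring

lemma tendsto_legendreInterp (hh : 0 < h) :
    Tendsto (legendreInterp d hh) atTop (𝓝 (H1.toL2CLM d 0 h)) := by
  have hinv : Tendsto (fun n : ℕ ↦ 1 / (4 * (n : ℝ))) atTop (𝓝 0) :=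
    tendsto_const_nhds.div_atTop (tendsto_natCast_atTop_atTop.const_mul_atTop four_pos)
  have hrate : Tendsto (fun n : ℕ ↦
      2 * √h * (h ^ (1 / 2 : ℝ) * (1 / (4 * (n : ℝ))) ^ (1 / 4 : ℝ))) atTop (𝓝 0) := by
    simpa using ((hinv.rpow_const (p := 1 / 4) (by norm_num)).const_mul (h ^ (1 / 2 : ℝ))).const_mul
      (2 * √h)
  refine (tendsto_iff_norm_sub_tendsto_zero (E := H1 d 0 h →L[ℝ] L2 d 0 h)).2 ?_
  rw [← tendsto_add_atTop_iff_nat 1]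
  refine squeeze_zero' (Eventually.of_forall fun n ↦
    norm_nonneg (legendreInterp d hh (n + 1) - H1.toL2CLM d 0 h)) ?_ hrate
  filter_upwards [eventually_ne_atTop 0] with n hn
  exact norm_legendreInterp_sub_le hh hn

end GaussianInterpolation

section Volterra

lemma isUnit_one_sub_of_norm_pow_lt_one {R : Type*} [NormedRing R] [HasSummableGeomSeries R]
    {x : R} {n : ℕ} (hx : ‖x ^ n‖ < 1) : IsUnit (1 - x) := by
  have hunit := isUnit_one_sub_of_norm_lt_one hx
  rw [← mul_neg_geom_sum] at hunit
  have hcomm : Commute (1 - x) (∑ i ∈ Finset.range n, x ^ i) :=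
    (mul_neg_geom_sum x n).trans (geom_sum_mul_neg x n).symm
  exact (hcomm.isUnit_mul_iff.1 hunit).1

variable {E : Type*} [NormedAddCommGroup E] [NormedSpace ℝ E] {p : ℝ≥0∞} [Fact (1 ≤ p)]
  {a b M : ℝ} {K : Lp E p (volume.restrict (Icc a b)) →L[ℝ] Lp E p (volume.restrict (Icc a b))}

lemma integral_Icc_sub_pow_div_factorial {t : ℝ} (hat : a ≤ t) (n : ℕ) :
    ∫ r in Icc a t, (r - a) ^ n / n.factorial = (t - a) ^ (n + 1) / (n + 1).factorial := by
  rw [integral_Icc_eq_integral_Ioc, ← intervalIntegral.integral_of_le hat,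
    intervalIntegral.integral_div, intervalIntegral.integral_comp_sub_right (· ^ n), integral_pow,
    Nat.factorial_succ]
  push_cast
  field_simp
  simp

lemma ae_norm_volterra_pow_le (hM : 0 ≤ M)
    (hK : ∀ w, ∀ᵐ t ∂volume.restrict (Icc a b), ‖K w t‖ ≤ M * ∫ r in Icc a t, ‖w r‖)
    (w : Lp E p (volume.restrict (Icc a b))) (n : ℕ) :
    ∀ᵐ t ∂volume.restrict (Icc a b), ‖(K ^ (n + 1)) w t‖ ≤
      M ^ (n + 1) * (∫ r in Icc a b, ‖w r‖) * ((t - a) ^ n / n.factorial) := by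
  have hint (v : Lp E p (volume.restrict (Icc a b))) : IntegrableOn v (Icc a b) :=
    (Lp.memLp v).integrable Fact.out
  induction n with
  | zero =>
    filter_upwards [hK w, ae_restrict_mem measurableSet_Icc] with t ht hmem
    simp only [zero_add, pow_one, pow_zero, Nat.factorial_zero, Nat.cast_one, div_one, mul_one]
    refine ht.trans (mul_le_mul_of_nonneg_left ?_ hM)
    exact setIntegral_mono_set (hint w).norm (Eventually.of_forall fun _ ↦ norm_nonneg _)
      (Icc_subset_Icc_right hmem.2).eventuallyLE
  | succ n ih =>
    have hstep := hK ((K ^ (n + 1)) w)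
    filter_upwards [hstep, ae_restrict_mem measurableSet_Icc] with t ht hmem
    have hsub : Icc a t ⊆ Icc a b := Icc_subset_Icc_right hmem.2
    have hcont : Continuous fun r : ℝ ↦
      M ^ (n + 1) * (∫ r in Icc a b, ‖w r‖) * ((r - a) ^ n / n.factorial) := by fun_prop
    rw [pow_succ' K (n + 1)]
    refine ht.trans ?_
    calc M * ∫ r in Icc a t, ‖(K ^ (n + 1)) w r‖
        ≤ M * ∫ r in Icc a t,
            M ^ (n + 1) * (∫ r in Icc a b, ‖w r‖) * ((r - a) ^ n / n.factorial) := by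
          refine mul_le_mul_of_nonneg_left ?_ hM
          exact integral_mono_ae ((hint _).mono_set hsub).norm hcont.integrableOn_Icc
            (ae_restrict_of_ae_restrict_of_subset hsub ih)
      _ = _ := by
          rw [integral_const_mul, integral_Icc_sub_pow_div_factorial hmem.1]
          ring

lemma norm_volterra_pow_le (hab : a < b) (hM : 0 ≤ M)
    (hK : ∀ w, ∀ᵐ t ∂volume.restrict (Icc a b), ‖K w t‖ ≤ M * ∫ r in Icc a t, ‖w r‖) (n : ℕ) :
    ‖K ^ (n + 1)‖ ≤ (b - a) * M * ((M * (b - a)) ^ n / n.factorial) := by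
  have hlen : 0 < b - a := sub_pos.2 hab
  refine ContinuousLinearMap.opNorm_le_bound _ (by positivity) fun w ↦ ?_
  have hw : ∫ r in Icc a b, ‖w r‖ ≤ ‖w‖ * (b - a) ^ (1 - p.toReal⁻¹) := by
    simpa [hab.le] using setIntegral_norm_le_norm_mul_rpow w (measure_ne_top _ univ)
  have : 0 ≤ ∫ r in Icc a b, ‖w r‖ := integral_nonneg fun _ ↦ norm_nonneg _
  have hpt : ∀ᵐ t ∂volume.restrict (Icc a b), ‖(K ^ (n + 1)) w t‖ ≤
      M ^ (n + 1) * (‖w‖ * (b - a) ^ (1 - p.toReal⁻¹)) * ((b - a) ^ n / n.factorial) := by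
    filter_upwards [ae_norm_volterra_pow_le hM hK w n, ae_restrict_mem measurableSet_Icc]
      with t ht hmem
    have hat : 0 ≤ t - a := sub_nonneg.2 hmem.1
    refine ht.trans ?_
    gcongr
    exact hmem.2
  have hsplit : (b - a) ^ p.toReal⁻¹ * (b - a) ^ (1 - p.toReal⁻¹) = b - a := by
    rw [← Real.rpow_add hlen, add_sub_cancel, Real.rpow_one]
  refine (Lp.norm_le_of_ae_bound (by positivity) hpt).trans_eq ?_
  rw [measureUnivNNReal, Measure.restrict_apply_univ, Real.volume_Icc,
    ENNReal.coe_toNNReal_eq_toReal, ENNReal.toReal_ofReal hlen.le, mul_pow, pow_succ]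
  linear_combination M ^ n * M * ‖w‖ * ((b - a) ^ n / n.factorial) * hsplit

lemma isUnit_one_sub_volterra [CompleteSpace E] (hab : a < b) (hM : 0 ≤ M)
    (hK : ∀ w, ∀ᵐ t ∂volume.restrict (Icc a b), ‖K w t‖ ≤ M * ∫ r in Icc a t, ‖w r‖) :
    IsUnit (1 - K) := by
  have hlim := (FloorSemiring.tendsto_pow_div_factorial_atTop (M * (b - a))).const_mul ((b - a) * M)
  rw [mul_zero] at hlim
  obtain ⟨n, hn⟩ := (hlim.eventually (gt_mem_nhds zero_lt_one)).exists
  exact isUnit_one_sub_of_norm_pow_lt_one ((norm_volterra_pow_le hab hM hK n).trans_lt hn)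

end Volterra

section Translation

variable {E : Type*} [NormedAddCommGroup E] [NormedSpace ℝ E] {p : ℝ≥0∞}

section ExtendByZero

variable {α : Type*} [MeasurableSpace α] {μ : Measure α} {s : Set α}

/-- Extension by zero, from the functions on `s` to the functions on the whole space. -/
noncomputable def extendByZeroₗ (hs : MeasurableSet s) : Lp E p (μ.restrict s) →ₗ[ℝ] Lp E p μ where
  toFun f := ((memLp_indicator_iff_restrict hs).2 (Lp.memLp f)).toLp (s.indicator f)
  map_add' f g := by
    rw [← MemLp.toLp_add, MemLp.toLp_eq_toLp_iff, ← indicator_add']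
    exact (ae_eq_restrict_iff_indicator_ae_eq hs).1 (Lp.coeFn_add f g)
  map_smul' c f := by
    rw [RingHom.id_apply, ← MemLp.toLp_const_smul, MemLp.toLp_eq_toLp_iff]
    exact ((ae_eq_restrict_iff_indicator_ae_eq hs).1 (Lp.coeFn_smul c f)).trans
      (ae_of_all μ fun x ↦ indicator_const_smul_apply s c f x)

lemma extendByZeroₗ_ae_eq (hs : MeasurableSet s) (f : Lp E p (μ.restrict s)) :
    extendByZeroₗ hs f =ᵐ[μ] s.indicator f :=
  ((memLp_indicator_iff_restrict hs).2 (Lp.memLp f)).coeFn_toLp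

variable [Fact (1 ≤ p)]

/-- `extendByZeroₗ` as a continuous linear map. -/
noncomputable def extendByZero (hs : MeasurableSet s) : Lp E p (μ.restrict s) →L[ℝ] Lp E p μ :=
  (extendByZeroₗ hs).mkContinuous 1 fun f ↦ by
    rw [one_mul, Lp.norm_def, eLpNorm_congr_ae (extendByZeroₗ_ae_eq hs f),
      eLpNorm_indicator_eq_eLpNorm_restrict hs, Lp.norm_def]

lemma extendByZero_ae_eq (hs : MeasurableSet s) (f : Lp E p (μ.restrict s)) :
    extendByZero hs f =ᵐ[μ] s.indicator f :=
  extendByZeroₗ_ae_eq hs f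

end ExtendByZero

lemma measurePreserving_const_add_Icc (c a b : ℝ) :
    MeasurePreserving (c + ·) (volume.restrict (Icc a b))
      (volume.restrict (Icc (c + a) (c + b))) := by
  simpa using (measurePreserving_add_left volume c).restrict_preimage
    (measurableSet_Icc (a := c + a) (b := c + b))

lemma ae_restrict_Icc_const_add_iff (c a b : ℝ) {P : ℝ → Prop} :
    (∀ᵐ t ∂volume.restrict (Icc a b), P (c + t)) ↔
      ∀ᵐ t ∂volume.restrict (Icc (c + a) (c + b)), P t := by
  rw [← (measurePreserving_const_add_Icc c a b).map_eq,
    (measurableEmbedding_addLeft c).ae_map_iff]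

lemma ae_restrict_Icc_const_add {a b a' b' c : ℝ} {P : ℝ → Prop}
    (hP : ∀ᵐ t ∂volume.restrict (Icc a b), P t) (ha : a ≤ c + a') (hb : c + b' ≤ b) :
    ∀ᵐ t ∂volume.restrict (Icc a' b'), P (c + t) :=
  (ae_restrict_Icc_const_add_iff c a' b').2
    (ae_restrict_of_ae_restrict_of_subset (Icc_subset_Icc ha hb) hP)

/-- Translation by `c` followed by restriction to `[a,b]`, that is `u ↦ u(c + ·)`. -/
noncomputable def translateRestrict (E : Type*) [NormedAddCommGroup E] [NormedSpace ℝ E]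
    (p : ℝ≥0∞) [Fact (1 ≤ p)] (c a b : ℝ) :
    Lp E p (volume : Measure ℝ) →L[ℝ] Lp E p (volume.restrict (Icc a b)) :=
  LpToLpRestrictCLM ℝ E ℝ volume p (Icc a b) ∘L (Lp.compMeasurePreservingₗᵢ ℝ (c + ·)
    (measurePreserving_add_left volume c)).toContinuousLinearMap

lemma translateRestrict_ae_eq [Fact (1 ≤ p)] (c a b : ℝ) (u : Lp E p (volume : Measure ℝ)) :
    translateRestrict E p c a b u =ᵐ[volume.restrict (Icc a b)] fun t ↦ u (c + t) :=
  (LpToLpRestrictCLM_coeFn ℝ (Icc a b) _).trans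
    (ae_restrict_of_ae (Lp.coeFn_compMeasurePreserving u (measurePreserving_add_left volume c)))

end Translation

section Glue

variable {d : ℕ} {τ h : ℝ}

/-- `V(φ,w)`, extended by zero outside `[-τ,h]`. -/
noncomputable def glue (d : ℕ) (τ h : ℝ) :
    L2 d (-τ) 0 × L2 d 0 h →L[ℝ] Lp (Vec d) 2 (volume : Measure ℝ) :=
  (extendByZero measurableSet_Icc).coprod (extendByZero measurableSet_Icc)

lemma glue_ae_eq (φ : L2 d (-τ) 0) (w : L2 d 0 h) :
    glue d τ h (φ, w) =ᵐ[volume.restrict (Icc (-τ) h)] V φ w := by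
  have hsum : glue d τ h (φ, w) =ᵐ[volume]
      (Icc (-τ) 0).indicator φ + (Icc 0 h).indicator w :=
    (Lp.coeFn_add _ _).trans
      ((extendByZero_ae_eq measurableSet_Icc φ).add (extendByZero_ae_eq measurableSet_Icc w))
  filter_upwards [ae_restrict_of_ae hsum, ae_restrict_mem measurableSet_Icc,
    ae_restrict_of_ae (volume.ae_ne 0)] with t ht hmem hne
  rw [ht, Pi.add_apply, V]
  rcases hne.lt_or_gt with hneg | hpos
  · rw [indicator_of_mem (show t ∈ Icc (-τ) 0 from ⟨hmem.1, hneg.le⟩),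
      indicator_of_notMem fun ht ↦ hneg.not_ge ht.1, if_neg hneg.not_gt, add_zero]
  · rw [indicator_of_notMem fun ht ↦ hpos.not_ge ht.2,
      indicator_of_mem (show t ∈ Icc 0 h from ⟨hpos.le, hmem.2⟩), if_pos hpos, zero_add]

end Glue

section Kernel

variable {α β E F : Type*} [MeasurableSpace α] [MeasurableSpace β] {μ : Measure α} {ν : Measure β}
  [NormedAddCommGroup E] [NormedAddCommGroup F]

lemma ae_memLp_top_prodMk_left [SFinite ν] {f : α × β → E} (hf : MemLp f ∞ (μ.prod ν)) :
    ∀ᵐ x ∂μ, MemLp (fun y ↦ f (x, y)) ∞ ν ∧ ∀ᵐ y ∂ν, ‖f (x, y)‖ ≤ lpNorm f ∞ (μ.prod ν) := by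
  filter_upwards [hf.1.prodMk_left, Measure.ae_ae_of_ae_prod (ae_le_lpNorm_exponent_top hf)]
    with x hmeas hle
  exact ⟨memLp_top_of_bound hmeas _ hle, hle⟩

variable [NormedSpace ℝ E] [NormedSpace ℝ F]

lemma integrable_clm_apply {c : α → E →L[ℝ] F} {v : α → E} (hc : MemLp c ∞ μ)
    (hv : Integrable v μ) : Integrable (fun x ↦ c x (v x)) μ :=
  (ContinuousLinearMap.id ℝ (E →L[ℝ] F)).integrable_of_bilin_of_bdd_left _ hc.1
    (ae_le_lpNorm_exponent_top hc) hv

lemma norm_integral_clm_apply_le {c : α → E →L[ℝ] F} {v : α → E} {M : ℝ}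
    (hM : ∀ᵐ x ∂μ, ‖c x‖ ≤ M) (hv : Integrable v μ) :
    ‖∫ x, c x (v x) ∂μ‖ ≤ M * ∫ x, ‖v x‖ ∂μ := by
  rw [← integral_const_mul]
  refine norm_integral_le_of_norm_le (hv.norm.const_mul M) ?_
  filter_upwards [hM] with x hx
  exact (c x).le_of_opNorm_le hx _

end Kernel

section DelayOperator

variable {d : ℕ} {τ s h t M : ℝ} {C : ℝ → ℝ → Matrix (Fin d) (Fin d) ℝ}

lemma HypC.memLp_toEuclideanCLM (hC : HypC τ s h C) :
    MemLp (fun p : ℝ × ℝ ↦ Matrix.toEuclideanCLM (𝕜 := ℝ) (C p.1 p.2)) ∞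
      ((volume.restrict (Icc s (s + h))).prod (volume.restrict (Icc (-τ) 0))) := by
  rw [Measure.prod_restrict]
  have hentries : MemLp (fun (p : ℝ × ℝ) i j ↦ C p.1 p.2 i j) ∞
      (volume.restrict (Icc s (s + h) ×ˢ Icc (-τ) 0)) :=
    MemLp.of_eval fun i ↦ MemLp.of_eval (hC i)
  exact (LinearMap.toContinuousLinearMap ((Matrix.toEuclideanCLM (n := Fin d)
    (𝕜 := ℝ)).toAlgEquiv.toLinearMap ∘ₗ (Matrix.ofLinearEquiv ℝ).toLinearMap)).comp_memLp'
      hentries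

lemma HypC.exists_ae_memLp_norm_le (hC : HypC τ s h C) : ∃ M, 0 ≤ M ∧
    ∀ᵐ t ∂volume.restrict (Icc 0 h),
      MemLp (fun θ ↦ Matrix.toEuclideanCLM (𝕜 := ℝ) (C (s + t) θ)) ∞
        (volume.restrict (Icc (-τ) 0)) ∧
      ∀ᵐ θ ∂volume.restrict (Icc (-τ) 0), ‖Matrix.toEuclideanCLM (𝕜 := ℝ) (C (s + t) θ)‖ ≤ M :=
  ⟨_, lpNorm_nonneg, ae_restrict_Icc_const_add (ae_memLp_top_prodMk_left hC.memLp_toEuclideanCLM)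
    (add_zero s).ge le_rfl⟩

lemma integrableOn_comp_const_add {v : ℝ → Vec d} (ht : t ∈ Icc 0 h)
    (hv : IntegrableOn v (Icc (-τ) h)) : IntegrableOn (fun θ ↦ v (t + θ)) (Icc (-τ) 0) :=
  (measurePreserving_const_add_Icc t (-τ) 0).integrable_comp_emb (measurableEmbedding_addLeft t)
    |>.2 (hv.mono_set (Icc_subset_Icc (by linarith [ht.1]) (by linarith [ht.2])))

lemma integrableOn_V {φ w : ℝ → Vec d} (hφ : IntegrableOn φ (Icc (-τ) 0))
    (hw : IntegrableOn w (Icc 0 h)) : IntegrableOn (V φ w) (Icc (-τ) h) := by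
  have hw' : IntegrableOn w (Ioi 0) (volume.restrict (Icc (-τ) h)) := by
    rw [IntegrableOn, Measure.restrict_restrict measurableSet_Ioi]
    exact hw.mono_set fun t ht ↦ ⟨ht.1.le, ht.2.2⟩
  have hφ' : IntegrableOn φ (Ioi 0)ᶜ (volume.restrict (Icc (-τ) h)) := by
    rw [IntegrableOn, Measure.restrict_restrict measurableSet_Ioi.compl]
    exact hφ.mono_set fun t ht ↦ ⟨ht.2.1, not_lt.1 ht.1⟩
  classical exact Integrable.piecewise measurableSet_Ioi hw' hφ'

lemma integrableOn_V_zero_left (w : L2 d 0 h) : IntegrableOn (V 0 w) (Icc (-τ) h) :=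
  integrableOn_V integrableOn_zero ((Lp.memLp w).integrable one_le_two)

lemma integrableOn_V_zero_right (φ : L2 d (-τ) 0) : IntegrableOn (V φ 0) (Icc (-τ) h) :=
  integrableOn_V ((Lp.memLp φ).integrable one_le_two) integrableOn_zero

lemma opF_congr {v v' : ℝ → Vec d} (ht : t ∈ Icc 0 h)
    (hv : v =ᵐ[volume.restrict (Icc (-τ) h)] v') : opF τ s C v t = opF τ s C v' t :=
  integral_congr_ae <| (ae_restrict_Icc_const_add hv (by linarith [ht.1])
    (by linarith [ht.2])).mono fun θ hθ ↦ congrArg (C (s + t) θ).toEuclideanLin hθ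

lemma opF_add {u v : ℝ → Vec d} (ht : t ∈ Icc 0 h)
    (hC : MemLp (fun θ ↦ Matrix.toEuclideanCLM (𝕜 := ℝ) (C (s + t) θ)) ∞
      (volume.restrict (Icc (-τ) 0)))
    (hu : IntegrableOn u (Icc (-τ) h)) (hv : IntegrableOn v (Icc (-τ) h)) :
    opF τ s C (u + v) t = opF τ s C u t + opF τ s C v t := by
  simp only [opF, Pi.add_apply, map_add]
  exact integral_add (integrable_clm_apply hC (integrableOn_comp_const_add ht hu))
    (integrable_clm_apply hC (integrableOn_comp_const_add ht hv))

lemma integral_norm_V_zero_le (ht : t ∈ Icc 0 h) (w : L2 d 0 h) :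
    ∫ θ in Icc (-τ) 0, ‖V 0 w (t + θ)‖ ≤ ∫ r in Icc 0 t, ‖w r‖ := by
  have hw : IntegrableOn w (Icc 0 h) := (Lp.memLp w).integrable one_le_two
  calc ∫ θ in Icc (-τ) 0, ‖V 0 w (t + θ)‖
      = ∫ r in Icc (t + -τ) (t + 0), (Ioi 0).indicator (fun r ↦ ‖w r‖) r := by
        rw [← (measurePreserving_const_add_Icc t (-τ) 0).integral_comp
          (measurableEmbedding_addLeft t)]
        refine integral_congr_ae (ae_of_all _ fun θ ↦ ?_)
        simp [V, indicator_apply, apply_ite norm]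
    _ = ∫ r in Icc (t + -τ) t ∩ Ioi 0, ‖w r‖ := by
        rw [add_zero, setIntegral_indicator measurableSet_Ioi]
    _ ≤ ∫ r in Icc 0 t, ‖w r‖ :=
        setIntegral_mono_set (hw.mono_set (Icc_subset_Icc_right ht.2)).norm
          (Eventually.of_forall fun _ ↦ norm_nonneg _)
          (Eventually.of_forall fun _ hx ↦ ⟨hx.2.le, hx.1.2⟩)

lemma norm_opF_V_zero_le (hM : 0 ≤ M) (ht : t ∈ Icc 0 h)
    (hC : ∀ᵐ θ ∂volume.restrict (Icc (-τ) 0), ‖Matrix.toEuclideanCLM (𝕜 := ℝ) (C (s + t) θ)‖ ≤ M)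
    (w : L2 d 0 h) : ‖opF τ s C (V 0 w) t‖ ≤ M * ∫ r in Icc 0 t, ‖w r‖ :=
  (norm_integral_clm_apply_le hC
      (integrableOn_comp_const_add ht (integrableOn_V_zero_left w))).trans
    (mul_le_mul_of_nonneg_left (integral_norm_V_zero_le ht w) hM)

end DelayOperator

section SolutionOperator

variable {X Y : Type*} [NormedAddCommGroup X] [NormedSpace ℝ X] [NormedAddCommGroup Y]
  [NormedSpace ℝ Y]

open ContinuousLinearMap

/-- The operator `φ ↦ w` solving `w = B(φ,w)`, that is `(1 - B(0,·))⁻¹ B(·,0)`. Junk when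
`1 - B(0,·)` is not invertible, as `Ring.inverse` then vanishes. -/
noncomputable def solutionOp (B : X × Y →L[ℝ] Y) : X →L[ℝ] Y :=
  Ring.inverse (1 - B ∘L inr ℝ X Y) ∘L B ∘L inl ℝ X Y

lemma solutionOp_apply (B : X × Y →L[ℝ] Y) (φ : X) :
    solutionOp B φ = Ring.inverse (1 - B ∘L inr ℝ X Y) (B (φ, 0)) :=
  rfl

lemma eq_apply_iff_eq_solutionOp {B : X × Y →L[ℝ] Y} (hB : IsUnit (1 - B ∘L inr ℝ X Y))
    {φ : X} {w : Y} : w = B (φ, w) ↔ w = solutionOp B φ := by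
  have hsplit : B (φ, w) = B (φ, 0) + B (0, w) := by simp [← map_add]
  have hsub : w = B (φ, w) ↔ (1 - B ∘L inr ℝ X Y) w = B (φ, 0) := by
    rw [hsplit, ← sub_eq_iff_eq_add]
    rfl
  rw [hsub, solutionOp_apply]
  constructor
  · intro hw
    rw [← hw, ← mul_apply_eq_comp, Ring.inverse_mul_cancel _ hB, one_apply_eq_self]
  · intro hw
    rw [hw, ← mul_apply_eq_comp, Ring.mul_inverse_cancel _ hB, one_apply_eq_self]

variable [CompleteSpace Y]

lemma eventually_isUnit_one_sub_comp_inr {B : X × Y →L[ℝ] Y}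
    (hB : IsUnit (1 - B ∘L inr ℝ X Y)) : ∀ᶠ B' in 𝓝 B, IsUnit (1 - B' ∘L inr ℝ X Y) := by
  have hsub : ContinuousAt (fun B' : X × Y →L[ℝ] Y ↦ 1 - B' ∘L inr ℝ X Y) B := by fun_prop
  exact hsub.eventually_mem (Units.isOpen.mem_nhds hB)

lemma continuousAt_solutionOp {B : X × Y →L[ℝ] Y} (hB : IsUnit (1 - B ∘L inr ℝ X Y)) :
    ContinuousAt solutionOp B := by
  have hsub : ContinuousAt (fun B' : X × Y →L[ℝ] Y ↦ 1 - B' ∘L inr ℝ X Y) B := by fun_prop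
  have hinv : ContinuousAt (fun B' : X × Y →L[ℝ] Y ↦ Ring.inverse (1 - B' ∘L inr ℝ X Y)) B :=
    ContinuousAt.comp_of_eq (NormedRing.inverse_continuousAt hB.unit) hsub hB.unit_spec.symm
  exact hinv.clm_comp (by fun_prop)

end SolutionOperator

section Setting

variable {d N : ℕ} {τ s h : ℝ} {C : ℝ → ℝ → Matrix (Fin d) (Fin d) ℝ}

lemma V_eq_add (φ w : ℝ → Vec d) : V φ w = V 0 w + V φ 0 := by
  ext1 t
  by_cases ht : 0 < t <;> simp [V, ht]

lemma V_ae_eq_left (φ w : ℝ → Vec d) : V φ w =ᵐ[volume.restrict (Icc (-τ) 0)] φ := by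
  filter_upwards [ae_restrict_mem measurableSet_Icc] with t ht
  rw [V, if_neg ht.2.not_gt]

lemma V_ae_eq_right (φ w : ℝ → Vec d) : V φ w =ᵐ[volume.restrict (Icc 0 h)] w := by
  rw [← restrict_Ioc_eq_restrict_Icc]
  filter_upwards [ae_restrict_mem measurableSet_Ioc] with t ht
  rw [V, if_pos ht.1]

lemma V_congr_ae {φ φ' w w' : ℝ → Vec d} (hφ : φ =ᵐ[volume.restrict (Icc (-τ) 0)] φ')
    (hw : w =ᵐ[volume.restrict (Icc 0 h)] w') :
    V φ w =ᵐ[volume.restrict (Icc (-τ) h)] V φ' w' := by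
  rw [EventuallyEq, ae_restrict_iff' measurableSet_Icc] at hφ hw ⊢
  filter_upwards [hφ, hw] with t hφt hwt ht
  rcases lt_or_ge 0 t with hpos | hneg
  · rw [V, V, if_pos hpos, if_pos hpos, hwt ⟨hpos.le, ht.2⟩]
  · rw [V, V, if_neg hneg.not_gt, if_neg hneg.not_gt, hφt ⟨ht.1, hneg⟩]

lemma V_self (y : ℝ → Vec d) : V y y = y :=
  funext fun _ ↦ ite_self _

lemma ae_eq_V_iff (hτ : 0 ≤ τ) (hh : 0 ≤ h) {φ w y : ℝ → Vec d} :
    y =ᵐ[volume.restrict (Icc (-τ) h)] V φ w ↔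
      y =ᵐ[volume.restrict (Icc (-τ) 0)] φ ∧ y =ᵐ[volume.restrict (Icc 0 h)] w := by
  refine ⟨fun hy ↦ ⟨?_, ?_⟩, fun ⟨hφ, hw⟩ ↦ V_self y ▸ V_congr_ae hφ hw⟩
  · exact EventuallyEq.trans (ae_restrict_of_ae_restrict_of_subset (Icc_subset_Icc_right hh) hy)
      (V_ae_eq_left φ w)
  · exact EventuallyEq.trans
      (ae_restrict_of_ae_restrict_of_subset (Icc_subset_Icc_left (neg_nonpos.2 hτ)) hy)
      (V_ae_eq_right φ w)

lemma isSolution_iff {φ : L2 d (-τ) 0} {x : L2 d (s - τ) (s + h)} :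
    IsSolution τ s h C φ x ↔
      (fun t ↦ x (s + t)) =ᵐ[volume.restrict (Icc (-τ) 0)] φ ∧
      (fun t ↦ x (s + t)) =ᵐ[volume.restrict (Icc 0 h)] opF τ s C fun t ↦ x (s + t) := by
  have hshift := ae_restrict_Icc_const_add_iff s 0 h
    (P := fun t ↦ x t = ∫ θ in Icc (-τ) 0, (C t θ).toEuclideanLin (x (t + θ)))
  rw [add_zero] at hshift
  rw [IsSolution, restrict_Ioc_eq_restrict_Icc, ← hshift]
  simp only [EventuallyEq, opF, add_assoc]

/-- `A` is `(φ,w) ↦ 𝓕 V(φ,w)`, as a bounded operator into `H¹`. -/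
def IsDelayOperator (τ s h : ℝ) (C : ℝ → ℝ → Matrix (Fin d) (Fin d) ℝ)
    (A : L2 d (-τ) 0 × L2 d 0 h →L[ℝ] H1 d 0 h) : Prop :=
  ∀ φ w, H1.toL2 (A (φ, w)) =ᵐ[volume.restrict (Icc 0 h)] opF τ s C (V φ w)

lemma exists_isDelayOperator (hC : HypC τ s h C) (hplus : HypPlus τ s h C)
    (hminus : HypMinus τ s h C) : ∃ A, IsDelayOperator τ s h C A := by
  obtain ⟨Aplus, hplus⟩ := hplus
  obtain ⟨Aminus, hminus⟩ := hminus
  obtain ⟨M, -, hM⟩ := hC.exists_ae_memLp_norm_le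
  refine ⟨Aminus.coprod Aplus, fun φ w ↦ ?_⟩
  filter_upwards [hM, ae_restrict_mem measurableSet_Icc, hplus w, hminus φ,
    Lp.coeFn_add (H1.toL2 (Aminus φ)) (H1.toL2 (Aplus w))] with t hCt ht hw hφ hadd
  rw [V_eq_add, opF_add ht hCt.1 (integrableOn_V_zero_left w) (integrableOn_V_zero_right φ),
    ← hw, ← hφ, add_comm]
  exact hadd

namespace IsDelayOperator

variable {A : L2 d (-τ) 0 × L2 d 0 h →L[ℝ] H1 d 0 h}

lemma isUnit_one_sub (hA : IsDelayOperator τ s h C A) (hC : HypC τ s h C) (hh : 0 < h) :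
    IsUnit (1 - (H1.toL2CLM d 0 h ∘L A) ∘L .inr ℝ (L2 d (-τ) 0) (L2 d 0 h)) := by
  obtain ⟨M, hM₀, hM⟩ := hC.exists_ae_memLp_norm_le
  refine isUnit_one_sub_volterra hh hM₀ fun w ↦ ?_
  have hzero := V_congr_ae (Lp.coeFn_zero (Vec d) 2 (volume.restrict (Icc (-τ) 0)))
    (ae_eq_refl (μ := volume.restrict (Icc 0 h)) w)
  filter_upwards [hM, ae_restrict_mem measurableSet_Icc, hA 0 w] with t hCt ht hAt
  refine Eq.trans_le (congrArg norm ?_) (norm_opF_V_zero_le hM₀ ht hCt.2 w)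
  exact hAt.trans (opF_congr ht hzero)

lemma isCollocationSolution_iff (hA : IsDelayOperator τ s h C A) (hh : 0 < h)
    (φ : L2 d (-τ) 0) (w : L2 d 0 h) :
    IsCollocationSolution τ s h C N φ w ↔ w = legendreInterp d hh N (A (φ, w)) := by
  constructor
  · rintro ⟨u, hu, huF, hw⟩
    exact Lp.ext (hw.trans (legendreInterp_ae_eq hh N hu (huF.trans (hA φ w).symm)).symm)
  · intro hw
    obtain ⟨u, hu, huA⟩ : ∃ u : ℝ → Vec d, ContinuousOn u (Icc 0 h) ∧
        u =ᵐ[volume.restrict (Icc 0 h)] H1.toL2 (A (φ, w)) := by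
      refine ⟨IccExtend hh.le (H1.toContinuous hh (A (φ, w))), ?_, ?_⟩
      · exact (map_continuous _).Icc_extend'.continuousOn
      · rw [← iccToLp_toContinuous hh]
        exact (iccToLp_ae_eq hh.le _).symm
    refine ⟨u, hu, huA.trans (hA φ w), ?_⟩
    nth_rw 1 [hw]
    exact legendreInterp_ae_eq hh N hu huA

lemma isSolution_iff_ae_eq_V (hA : IsDelayOperator τ s h C A) (hC : HypC τ s h C) (hτ : 0 ≤ τ)
    (hh : 0 < h) {φ : L2 d (-τ) 0} {x : L2 d (s - τ) (s + h)} :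
    IsSolution τ s h C φ x ↔ (fun t ↦ x (s + t)) =ᵐ[volume.restrict (Icc (-τ) h)]
      V φ (solutionOp (H1.toL2CLM d 0 h ∘L A) φ) := by
  have hfix {w : L2 d 0 h} : w = H1.toL2 (A (φ, w)) ↔ w = solutionOp (H1.toL2CLM d 0 h ∘L A) φ :=
    eq_apply_iff_eq_solutionOp (hA.isUnit_one_sub hC hh)
  rw [isSolution_iff]
  constructor
  · rintro ⟨hφ, hopF⟩
    have hmem : MemLp (fun t ↦ x (s + t)) 2 (volume.restrict (Icc 0 h)) :=
      ((Lp.memLp x).mono_measure (Measure.restrict_mono_set _ (Icc_subset_Icc_left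
        (by linarith)))).comp_measurePreserving (measurePreserving_const_add_Icc s 0 h)
    set w := hmem.toLp
    have hw : (fun t ↦ x (s + t)) =ᵐ[volume.restrict (Icc 0 h)] w := hmem.coeFn_toLp.symm
    have hV := (ae_eq_V_iff hτ hh.le).2 ⟨hφ, hw⟩
    suffices heq : w = H1.toL2 (A (φ, w)) from hfix.1 heq ▸ hV
    refine Lp.ext ?_
    filter_upwards [hw, hopF, ae_restrict_mem measurableSet_Icc, hA φ w] with t hwt hFt ht hAt
    rw [← hwt, hFt, opF_congr ht hV, hAt]
  · intro hx
    obtain ⟨hφ, hw⟩ := (ae_eq_V_iff hτ hh.le).1 hx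
    refine ⟨hφ, ?_⟩
    set w := solutionOp (H1.toL2CLM d 0 h ∘L A) φ
    filter_upwards [hw, ae_restrict_mem measurableSet_Icc, hA φ w] with t hwt ht hAt
    rw [hwt, opF_congr ht hx, ← hAt, ← hfix.2 rfl]

lemma existsUnique_isSolution (hA : IsDelayOperator τ s h C A) (hC : HypC τ s h C) (hτ : 0 ≤ τ)
    (hh : 0 < h) (φ : L2 d (-τ) 0) : ∃! x : L2 d (s - τ) (s + h), IsSolution τ s h C φ x := by
  simp only [hA.isSolution_iff_ae_eq_V hC hτ hh]
  generalize solutionOp (H1.toL2CLM d 0 h ∘L A) φ = w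
  have hshift {y : ℝ → Vec d} {x : L2 d (s - τ) (s + h)} :
      (fun t ↦ x (s + t)) =ᵐ[volume.restrict (Icc (-τ) h)] (fun t ↦ y (s + t)) ↔
        x =ᵐ[volume.restrict (Icc (s - τ) (s + h))] y :=
    ae_restrict_Icc_const_add_iff s (-τ) h (P := fun t ↦ x t = y t)
  set x := translateRestrict (Vec d) 2 (-s) (s - τ) (s + h) (glue d τ h (φ, w))
  have hxV : (fun t ↦ x (s + t)) =ᵐ[volume.restrict (Icc (-τ) h)] V φ w := by
    have hxglue :=
      (hshift (y := fun t ↦ glue d τ h (φ, w) (-s + t))).2 (translateRestrict_ae_eq _ _ _ _)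
    simp only [neg_add_cancel_left] at hxglue
    exact hxglue.trans (glue_ae_eq φ w)
  exact ⟨x, hxV, fun x' hx' ↦ Lp.ext (hshift.1 (hx'.trans hxV.symm))⟩

end IsDelayOperator

/-- The operator `φ ↦ V(φ, S φ)(h + ·)` on `L²([-τ,0])`: it is `T` when `S φ` solves the exact
equation, and `T_N` when `S φ` solves the collocation equation. -/
noncomputable def evolve (S : L2 d (-τ) 0 →L[ℝ] L2 d 0 h) :
    L2 d (-τ) 0 →L[ℝ] L2 d (-τ) 0 :=
  translateRestrict (Vec d) 2 h (-τ) 0 ∘L glue d τ h ∘L (ContinuousLinearMap.id ℝ _).prod S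

lemma evolve_ae_eq (hh : 0 ≤ h) (S : L2 d (-τ) 0 →L[ℝ] L2 d 0 h) (φ : L2 d (-τ) 0) :
    evolve S φ =ᵐ[volume.restrict (Icc (-τ) 0)] fun θ ↦ V φ (S φ) (h + θ) :=
  (translateRestrict_ae_eq h (-τ) 0 _).trans <|
    ae_restrict_Icc_const_add (glue_ae_eq φ (S φ)) (by linarith) (by linarith)

lemma continuous_evolve : Continuous (evolve : (L2 d (-τ) 0 →L[ℝ] L2 d 0 h) → _) := by
  have hprod : Continuous fun S : L2 d (-τ) 0 →L[ℝ] L2 d 0 h ↦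
      (ContinuousLinearMap.id ℝ _).prod S :=
    (ContinuousLinearMap.prodₗᵢ ℝ).continuous.comp (Continuous.prodMk_right _)
  unfold evolve
  fun_prop

lemma IsDelayOperator.isEvolutionOperator {A : L2 d (-τ) 0 × L2 d 0 h →L[ℝ] H1 d 0 h}
    (hA : IsDelayOperator τ s h C A) (hC : HypC τ s h C) (hτ : 0 ≤ τ) (hh : 0 < h) :
    IsEvolutionOperator τ s h C (evolve (solutionOp (H1.toL2CLM d 0 h ∘L A))) := by
  intro φ x hx
  have hxV := (hA.isSolution_iff_ae_eq_V hC hτ hh).1 hx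
  have hshift : ∀ᵐ θ ∂volume.restrict (Icc (-τ) 0), x (s + (h + θ)) = _ :=
    ae_restrict_Icc_const_add hxV (by linarith) (by linarith)
  filter_upwards [evolve_ae_eq hh.le _ φ, hshift] with θ hθ hxθ
  rw [hθ, add_assoc, hxθ]

end Setting

end RenewalEq

open RenewalEq in
theorem mainTheorem3_general (d : ℕ) (τ s h : ℝ) (hτ : 0 ≤ τ) (hh : 0 < h)
    (C : ℝ → ℝ → Matrix (Fin d) (Fin d) ℝ) (hC : HypC τ s h C) (hplus : HypPlus τ s h C)
    (hminus : HypMinus τ s h C) :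
    (∀ φ : L2 d (-τ) 0, ∃! x : L2 d (s - τ) (s + h), IsSolution τ s h C φ x) ∧
    ∃ N₀ : ℕ,
      (∀ N ≥ N₀, ∀ φ : L2 d (-τ) 0, ∃! w : L2 d 0 h, IsCollocationSolution τ s h C N φ w) ∧
      ∃ (T : L2 d (-τ) 0 →L[ℝ] L2 d (-τ) 0) (TN : ℕ → L2 d (-τ) 0 →L[ℝ] L2 d (-τ) 0),
        IsEvolutionOperator τ s h C T ∧
        (∀ N ≥ N₀, IsCollocationOperator τ s h C N (TN N)) ∧
        Tendsto (fun N ↦ ‖TN N - T‖) atTop (𝓝 0) := by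
  obtain ⟨A, hA⟩ := exists_isDelayOperator hC hplus hminus
  have hunit := hA.isUnit_one_sub hC hh
  have hlim : Tendsto (fun N ↦ legendreInterp d hh N ∘L A) atTop (𝓝 (H1.toL2CLM d 0 h ∘L A)) :=
    ((continuous_id.clm_comp_const A).tendsto _).comp (tendsto_legendreInterp hh)
  obtain ⟨N₀, hN₀⟩ := eventually_atTop.1
    (hlim.eventually (eventually_isUnit_one_sub_comp_inr hunit))
  have hcol {N} (hN : N ≥ N₀) (φ w) : IsCollocationSolution τ s h C N φ w ↔
      w = solutionOp (legendreInterp d hh N ∘L A) φ :=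
    (hA.isCollocationSolution_iff hh φ w).trans (eq_apply_iff_eq_solutionOp (hN₀ N hN))
  refine ⟨hA.existsUnique_isSolution hC hτ hh, N₀,
    fun N hN φ ↦ by simp only [hcol hN, existsUnique_eq],
    evolve (solutionOp (H1.toL2CLM d 0 h ∘L A)),
    fun N ↦ evolve (solutionOp (legendreInterp d hh N ∘L A)),
    hA.isEvolutionOperator hC hτ hh, fun N hN φ w hw ↦ ?_, ?_⟩
  · rw [(hcol hN φ w).1 hw]
    exact evolve_ae_eq hh.le _ φ
  · exact tendsto_iff_norm_sub_tendsto_zero.1 <|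
      ((continuous_evolve.tendsto _).comp (continuousAt_solutionOp hunit)).comp hlim

theorem mainTheorem3 (d : ℕ) (hd : 0 < d) (τ s h : ℝ) (hτ : 0 < τ) (hh : τ ≤ h)
    (C : ℝ → ℝ → Matrix (Fin d) (Fin d) ℝ)
    (H1 : RenewalEq.HypC τ s h C)
    (H2 : RenewalEq.HypPlus τ s h C)
    (H3 : RenewalEq.HypMinus τ s h C) :
    (∀ φ : RenewalEq.L2 d (-τ) 0, ∃! x : RenewalEq.L2 d (s - τ) (s + h),
      RenewalEq.IsSolution τ s h C φ x) ∧
    ∃ N₀ : ℕ,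
      (∀ N ≥ N₀, ∀ φ : RenewalEq.L2 d (-τ) 0, ∃! w : RenewalEq.L2 d 0 h,
        RenewalEq.IsCollocationSolution τ s h C N φ w) ∧
      ∃ (T : RenewalEq.L2 d (-τ) 0 →L[ℝ] RenewalEq.L2 d (-τ) 0)
        (TN : ℕ → RenewalEq.L2 d (-τ) 0 →L[ℝ] RenewalEq.L2 d (-τ) 0),
        RenewalEq.IsEvolutionOperator τ s h C T ∧
        (∀ N ≥ N₀, RenewalEq.IsCollocationOperator τ s h C N (TN N)) ∧
        Tendsto (fun N => ‖TN N - T‖) atTop (𝓝 0) :=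
  mainTheorem3_general d τ s h hτ.le (hτ.trans_le hh) C H1 H2 H3
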